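/- **Setting.** Let $n$ be odd, $m>0$, $\Lambda\le 0$, $\tilde\kappa\in\{-1,0,1\}$, $\kappa\neq 0$, and let $\mathcal S_0$ be a connected $n$-dimensional Riemannian manifold of constant curvature $\tilde\kappa$ with metric $(\sigma_{ij})$. Put $$\tilde h(r)=m|r|^{-(n-1)}+\tfrac{2}{n(n+1)}\Lambda r^2-\tilde\kappa ,$$ and assume there is a horizon $r_0>0$, i.e. $\tilde h(r_0)=0$ and $\tilde h>0$ on $(0,r_0)$. The bulk $\mathcal N=\{r<0\}$ and the reflected bulk $\hat{\mathcal N}=\{r>0\}$ are the parts of $\mathbb R\times\mathbb R\times\mathcal S_0\ni(r,t,x)$, with the metric $-\tilde h^{-1}dr^2+\tilde h\,dt^2+r^2\sigma_{ij}dx^idx^j$. A *brane* over an interval $I\subset(-r_0,0)$ or $I\subset(0,r_0)$ is a smooth timelike graph $t=u(r)$, $r\in I$, with a smooth scalar fields map $\varphi=\varphi(r)$ into a semi-Riemannian manifold $(\mathcal S,g_{AB})$ with smooth potential $V$, perfect fluids with $p_k=\frac{\omega_k}{n}\rho_k$, $\rho_k=\bar\rho_k|r|^{-(n+\omega_k)}$,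 $\bar\rho_k\ge0$, $0\le k\le k_0$, where the integers $\omega_k$ are odd, $\omega_0=n$, and $\omega_k<n$ for $k\ge1$, and a constant tension $\sigma$, such that the wave equation $\Delta\varphi^A=\partial V/\partial\varphi_A$ and the Israel junction conditions $h_{\alpha\beta}-H\bar g_{\alpha\beta}=\kappa(\hat T_{\alpha\beta}-\sigma\bar g_{\alpha\beta})$ hold. Here $\bar g_{\alpha\beta}$ is the induced metric, $\hat T_{\alpha\beta}$ is the total stress-energy tensor of the fluids and of $\varphi$, and the second fundamental form $h_{\alpha\beta}$, with the sign given by the Gauss formula $y_{\alpha\beta}=-h_{\alpha\beta}\nu$, is taken with respect to the unit normal $\nu$ exterior to the domain that the brane bounds. The brane is *upper* ($\nu^t>0$) if the domain lies below it, and *lower* ($\nu^t<0$) if the domain lies above it, with respect to $t$. The matter data ($\mathcal S$, $V$, $\omega_k$, $\bar\rho_k$, $\sigma$) may differ from brane to brane. A brane $N$ over $(-\epsilon,0)$ is *globally extended* across $r=0$ if $u$ and $\varphi$ are defined and smooth on $(-\epsilon,\epsilon)$, their restrictions to $(0,\epsilon)$ form a brane $\hat N\subset\hat{\mathcal N}$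 (upper or lower), $\frac{d\varphi}{dr}=r^{n-1}\chi$ for a smooth vector field $\chi$ along $\varphi$ with $\|\chi(0)\|^2>0$ and $2\frac{\kappa^2}{n^2}\|\chi(0)\|^2\bar\rho_0<1$, and $\lim_{r\to0}\rho\, r^{2n}$ exists and is greater than $\bar\rho_0$, where $\rho=-\frac12\|D\varphi\|^2+V(\varphi)$. Two branes over $I$ *bound a domain* over $I$ if there is a non-empty connected open subset of $I\times\mathbb R\times\mathcal S_0$ whose boundary in $I\times\mathbb R\times\mathcal S_0$ is the union of the two branes, such that it lies locally on one side of each of them, and the Israel conditions hold with the normals exterior to it. **Theorem 0.3.** Let $N_i=\{t=u_i(r)\}$, $i=1,2$, be two branes over $(-\epsilon,0)$, each globally extended across $r=0$, with reflected branes $\hat N_i$. (i) Suppose that, over $(-\delta,0)$ for some $0<\delta\le\epsilon$, $N_1$ and $N_2$ bound a domain $\Omega$ with $N_1$ as upper and $N_2$ as lower brane. Then $\hat N_1$ and $\hat N_2$ bound a domain $\hat\Omega\subset\hat{\mathcal N}$ over $(0,\eta)$ for some $0<\eta\le\epsilon$ if and only if $N_1$ and $N_2$ collide at the singularity, i.e.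 $u_1(0)=u_2(0)$. (ii) In the situation of (i) the branes switch positions: whenever $\hat N_1$ and $\hat N_2$ bound a domain $\hat\Omega$ over $(0,\eta)$, $0<\eta\le\epsilon$, then $\hat N_1$ is the lower and $\hat N_2$ the upper brane of $\hat\Omega$, and $\hat\Omega=\{(r,t,x):0<r<\eta,\ u_1(r)<t<u_2(r)\}$. (iii) Collision can always be arranged by translating one brane: without any assumption on $\Omega$, there is $c\in\mathbb R$ such that the brane $t=u_2(r)+c$, with the same scalar fields, is again globally extended across $r=0$, and collides with $N_1$ at $r=0$. If moreover $\kappa>0$, and $N_1$ is an upper and $N_2$ a lower brane over $(-\epsilon,0)$, then for some $0<\eta\le\epsilon$ the branes $t=u_1(r)$ and $t=u_2(r)+c$ bound a domain $\Omega$ over $(-\eta,0)$, with $N_1$ as upper and the translated brane as lower brane, and also a domain $\hat\Omega$ over $(0,\eta)$, with the positions switched. -/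

import Mathlib

open Set Filter Topology Bundle
open scoped Manifold ContDiff

noncomputable section

namespace BraneWorld

/-! ## Tensor calculus in coordinates -/

section Coordinates

variable {ι α : Type} [Fintype ι] [DecidableEq ι] [Fintype α] [DecidableEq α]

/-- The partial derivative `∂ᵢ f` of a function of the coordinates `z = (zⁱ)`. -/
def pd (i : ι) (f : (ι → ℝ) → ℝ) (z : ι → ℝ) : ℝ :=
  deriv (fun s => f (Function.update z i s)) (z i)

/-- Christoffel symbols of the first kind,
`Γ_{c,ab} = ½ (∂ₐ g_{cb} + ∂_b g_{ca} - ∂_c g_{ab})`. -/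
def christoffelLow (G : (ι → ℝ) → Matrix ι ι ℝ) (z : ι → ℝ) (c a b : ι) : ℝ :=
  (1 / 2) * (pd a (fun w => G w c b) z + pd b (fun w => G w c a) z - pd c (fun w => G w a b) z)

/-- Christoffel symbols `Γ^c_{ab} = g^{cd} Γ_{d,ab}`. -/
def christoffel (G : (ι → ℝ) → Matrix ι ι ℝ) (z : ι → ℝ) (c a b : ι) : ℝ :=
  ∑ d, (G z)⁻¹ c d * christoffelLow G z d a b

/-- Curvature tensor `R^a_{bcd}`, with `R(∂_c, ∂_d) ∂_b = R^a_{bcd} ∂_a`. -/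
def riemann (G : (ι → ℝ) → Matrix ι ι ℝ) (z : ι → ℝ) (a b c d : ι) : ℝ :=
  pd c (fun w => christoffel G w a d b) z - pd d (fun w => christoffel G w a c b) z
    + ∑ e, (christoffel G z a c e * christoffel G z e d b
      - christoffel G z a d e * christoffel G z e c b)

/-- The metric induced by `y` from the ambient metric `G`. -/
def inducedMetric (G : (ι → ℝ) → Matrix ι ι ℝ) (y : (α → ℝ) → ι → ℝ) (z : α → ℝ) :
    Matrix α α ℝ :=
  Matrix.of fun a b =>
    ∑ c, ∑ d, G (y z) c d * pd a (fun w => y w c) z * pd b (fun w => y w d) z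

/-- The second fundamental form of a hypersurface `y` with respect to a spacelike unit normal `ν`,
with the sign convention of the Gauss formula `y_{αβ} = - h_{αβ} ν`, that is,
`h_{αβ} = - ⟨∂_α ∂_β y + Γ(∂_α y, ∂_β y), ν⟩`. The term `⟨Γ(·,·), ν⟩` is written with the
Christoffel symbols of the first kind. -/
def secondFundamentalForm (G : (ι → ℝ) → Matrix ι ι ℝ) (y : (α → ℝ) → ι → ℝ) (ν : ι → ℝ)
    (z : α → ℝ) : Matrix α α ℝ :=
  Matrix.of fun a b =>
    -(∑ c, ∑ d, G (y z) c d * ν c * pd a (pd b (fun w => y w d)) z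
      + ∑ c, ∑ d, ∑ e, christoffelLow G (y z) c d e * ν c *
          pd a (fun w => y w d) z * pd b (fun w => y w e) z)

end Coordinates

/-! ## Semi-Riemannian manifolds -/

/-- A smooth semi-Riemannian metric (of arbitrary signature) on a `d`-dimensional manifold. -/
structure SemiRiemannianMetric (d : ℕ) (M : Type*) [TopologicalSpace M]
    [ChartedSpace (EuclideanSpace ℝ (Fin d)) M] [IsManifold (𝓡 d) ∞ M] where
  /-- the scalar product on the tangent spaces -/
  val : (x : M) → TangentSpace (𝓡 d) x →L[ℝ] TangentSpace (𝓡 d) x →L[ℝ] ℝ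
  symm : ∀ (x : M) (v w : TangentSpace (𝓡 d) x), val x v w = val x w v
  nondegenerate : ∀ (x : M) (v : TangentSpace (𝓡 d) x), (∀ w, val x v w = 0) → v = 0
  smooth : ContMDiff (𝓡 d)
    ((𝓡 d).prod 𝓘(ℝ, EuclideanSpace ℝ (Fin d) →L[ℝ] EuclideanSpace ℝ (Fin d) →L[ℝ] ℝ)) ∞
    (fun x => TotalSpace.mk' (EuclideanSpace ℝ (Fin d) →L[ℝ] EuclideanSpace ℝ (Fin d) →L[ℝ] ℝ)
      x (val x))

/-- The chart of `M` around `p`, read as an `n`-tuple of coordinates. -/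
def coords {d : ℕ} {M : Type*} [TopologicalSpace M] [ChartedSpace (EuclideanSpace ℝ (Fin d)) M]
    (p q : M) : Fin d → ℝ :=
  WithLp.ofLp (extChartAt (𝓡 d) p q)

/-- The point of `M` that has the coordinates `x` in the chart around `p`. -/
def point {d : ℕ} {M : Type*} [TopologicalSpace M] [ChartedSpace (EuclideanSpace ℝ (Fin d)) M]
    (p : M) (x : Fin d → ℝ) : M :=
  (extChartAt (𝓡 d) p).symm (WithLp.toLp 2 x)

/-- The coordinate domain of the chart around `p`. -/
def coordDomain {d : ℕ} {M : Type*} [TopologicalSpace M]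
    [ChartedSpace (EuclideanSpace ℝ (Fin d)) M] (p : M) : Set (Fin d → ℝ) :=
  {x | WithLp.toLp 2 x ∈ (extChartAt (𝓡 d) p).target}

namespace SemiRiemannianMetric

variable {d : ℕ} {M : Type*} [TopologicalSpace M] [ChartedSpace (EuclideanSpace ℝ (Fin d)) M]
  [IsManifold (𝓡 d) ∞ M]

/-- The metric is positive definite. -/
def IsRiemannian (g : SemiRiemannianMetric d M) : Prop :=
  ∀ (x : M) (v : TangentSpace (𝓡 d) x), v ≠ 0 → 0 < g.val x v v

/-- The components `g_{ij}` of the metric in the chart around `p`. -/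
def components (g : SemiRiemannianMetric d M) (p : M) (x : Fin d → ℝ) :
    Matrix (Fin d) (Fin d) ℝ :=
  Matrix.of fun i j =>
    g.val (point p x)
      (mfderiv 𝓘(ℝ, EuclideanSpace ℝ (Fin d)) (𝓡 d) (extChartAt (𝓡 d) p).symm (WithLp.toLp 2 x)
        (EuclideanSpace.single i (1 : ℝ)))
      (mfderiv 𝓘(ℝ, EuclideanSpace ℝ (Fin d)) (𝓡 d) (extChartAt (𝓡 d) p).symm (WithLp.toLp 2 x)
        (EuclideanSpace.single j (1 : ℝ)))

/-- All sectional curvatures are equal to `K`: `R(X, Y) Z = K (⟨Y, Z⟩ X - ⟨X, Z⟩ Y)`. -/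
def HasConstantCurvature (g : SemiRiemannianMetric d M) (K : ℝ) : Prop :=
  ∀ (p : M), ∀ x ∈ coordDomain p, ∀ a b c e : Fin d,
    riemann (g.components p) x a b c e =
      K * (g.components p x e b * (if a = c then 1 else 0)
        - g.components p x c b * (if a = e then 1 else 0))

/-- The pull-back `g_{AB} Φ^A_α Φ^B_β` of the metric by a map `Φ` of the coordinates `z`. -/
def pullback {α : Type} [Fintype α] [DecidableEq α] (g : SemiRiemannianMetric d M)
    (Φ : (α → ℝ) → M) (z : α → ℝ) : Matrix α α ℝ :=
  Matrix.of fun a b =>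
    g.val (Φ z) (mfderiv 𝓘(ℝ, α → ℝ) (𝓡 d) Φ z (Pi.single a (1 : ℝ)))
      (mfderiv 𝓘(ℝ, α → ℝ) (𝓡 d) Φ z (Pi.single b (1 : ℝ)))

/-- The components `Δ Φ^A = G^{αβ} (∂_α ∂_β Φ^A - Γ^γ_{αβ} ∂_γ Φ^A + Γ^A_{BC} ∂_α Φ^B ∂_β Φ^C)`
of the Laplacian of a map `Φ` into `M`, with respect to the metric `G` on its domain and
in the chart of `M` around `Φ z`. -/
def laplacian {α : Type} [Fintype α] [DecidableEq α] (g : SemiRiemannianMetric d M)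
    (G : (α → ℝ) → Matrix α α ℝ) (Φ : (α → ℝ) → M) (z : α → ℝ) (A : Fin d) : ℝ :=
  ∑ a, ∑ b, (G z)⁻¹ a b *
    (pd a (pd b (fun w => coords (Φ z) (Φ w) A)) z
      - ∑ c, christoffel G z c a b * pd c (fun w => coords (Φ z) (Φ w) A) z
      + ∑ B, ∑ C, christoffel (g.components (Φ z)) (coords (Φ z) (Φ z)) A B C *
          pd a (fun w => coords (Φ z) (Φ w) B) z * pd b (fun w => coords (Φ z) (Φ w) C) z)

/-- The components `g^{AB} ∂_B V` of the gradient of `V` at `q`, in the chart around `q`. -/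
def gradient (g : SemiRiemannianMetric d M) (V : M → ℝ) (q : M) (A : Fin d) : ℝ :=
  ∑ B, (g.components q (coords q q))⁻¹ A B * pd B (fun x => V (point q x)) (coords q q)

end SemiRiemannianMetric

/-! ## The bulk -/

/-- The function `h̃(r) = m |r|^{-(n-1)} + 2/(n(n+1)) Λ r² - κ̃`. -/
def warp (n : ℕ) (m Λ curv r : ℝ) : ℝ :=
  m / |r| ^ (n - 1) + 2 / ((n : ℝ) * ((n : ℝ) + 1)) * Λ * r ^ 2 - curv

/-- The parameters of a Schwarzschild-AdS bulk of dimension `n + 2` with black (white) hole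
region `{0 < |r| < r₀}`: the mass `m > 0`, the cosmological constant `Λ ≤ 0`, and the curvature
`κ̃ ∈ {-1, 0, 1}` of the spatial sections (called `curv`). The existence of the horizon `r₀`
forces `κ̃ = 1` if `Λ = 0`. -/
structure Bulk (n : ℕ) where
  m : ℝ
  Λ : ℝ
  curv : ℝ
  r₀ : ℝ
  m_pos : 0 < m
  Λ_nonpos : Λ ≤ 0
  curv_mem : curv = -1 ∨ curv = 0 ∨ curv = 1
  r₀_pos : 0 < r₀
  warp_pos : ∀ r, 0 < r → r < r₀ → 0 < warp n m Λ curv r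
  warp_horizon : warp n m Λ curv r₀ = 0

/-- `h̃` for a given bulk. -/
def Bulk.h {n : ℕ} (B : Bulk n) (r : ℝ) : ℝ := warp n B.m B.Λ B.curv r

/-- The components of the bulk metric `-h̃⁻¹ dr² + h̃ dt² + r² σ_{ij} dxⁱ dxʲ`, where the
coordinates are `inl 0 = r`, `inl 1 = t`, `inr i = xⁱ`, and `Q = (σ_{ij})`.
Both the bulk `{r < 0}` with its black hole and the reflected bulk `{r > 0}` with its white hole
carry this metric. -/
def Bulk.metric {n : ℕ} (B : Bulk n) (Q : (Fin n → ℝ) → Matrix (Fin n) (Fin n) ℝ)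
    (z : Fin 2 ⊕ Fin n → ℝ) : Matrix (Fin 2 ⊕ Fin n) (Fin 2 ⊕ Fin n) ℝ :=
  Matrix.fromBlocks (Matrix.diagonal ![-(B.h (z (Sum.inl 0)))⁻¹, B.h (z (Sum.inl 0))]) 0 0
    ((z (Sum.inl 0)) ^ 2 • Q (fun i => z (Sum.inr i)))

/-! ## Branes -/

/-- The embedding `(r, xⁱ) ↦ (r, u(r), xⁱ)`; the brane coordinates are `inl () = r` and
`inr i = xⁱ`. -/
def graphEmbedding (n : ℕ) (u : ℝ → ℝ) (z : Unit ⊕ Fin n → ℝ) : Fin 2 ⊕ Fin n → ℝ :=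
  Sum.elim ![z (Sum.inl ()), u (z (Sum.inl ()))] (fun i => z (Sum.inr i))

/-- The position of a brane with respect to the domain it bounds: the domain lies below an upper
brane and above a lower brane, with respect to the `t`-direction. -/
inductive Side
  | upper
  | lower

/-- `+1` for an upper and `-1` for a lower brane. -/
def Side.sign : Side → ℝ
  | .upper => 1
  | .lower => -1

/-- The unit normal of the graph `t = u(r)` that points to the exterior of the domain, i.e., with
`ν^t > 0` for an upper brane and `ν^t < 0` for a lower brane. -/
def exteriorNormal {n : ℕ} (B : Bulk n) (u : ℝ → ℝ) (s : Side) (r : ℝ) : Fin 2 ⊕ Fin n → ℝ :=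
  Sum.elim
    ![s.sign * ((B.h r) ^ 2 * deriv u r) /
        (Real.sqrt (B.h r) * Real.sqrt (1 - (B.h r) ^ 2 * (deriv u r) ^ 2)),
      s.sign / (Real.sqrt (B.h r) * Real.sqrt (1 - (B.h r) ^ 2 * (deriv u r) ^ 2))]
    (fun _ => 0)

/-- The matter on a brane of dimension `n + 1`: scalar fields with values in the semi-Riemannian
moduli space `S` with potential `V`, perfect fluids with equation of state `p_k = (ω_k / n) ρ_k` (where `ω_k` is `w k`),
`0 ≤ k ≤ k₀`, with integration constants `\bar ρ_k`, and the tension of the brane. -/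
structure Matter (n d : ℕ) (S : Type*) [TopologicalSpace S]
    [ChartedSpace (EuclideanSpace ℝ (Fin d)) S] [IsManifold (𝓡 d) ∞ S] where
  metric : SemiRiemannianMetric d S
  V : S → ℝ
  V_smooth : ContMDiff (𝓡 d) 𝓘(ℝ, ℝ) ∞ V
  tension : ℝ
  k₀ : ℕ
  w : Fin (k₀ + 1) → ℤ
  ρbar : Fin (k₀ + 1) → ℝ
  w_zero : w 0 = n
  w_lt : ∀ k, k ≠ 0 → w k < n
  ρbar_nonneg : ∀ k, 0 ≤ ρbar k

section Branes

variable {n d : ℕ}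
  {S₀ : Type*} [TopologicalSpace S₀] [ChartedSpace (EuclideanSpace ℝ (Fin n)) S₀]
  [IsManifold (𝓡 n) ∞ S₀]
  {S : Type*} [TopologicalSpace S] [ChartedSpace (EuclideanSpace ℝ (Fin d)) S]
  [IsManifold (𝓡 d) ∞ S]

/-- The energy density `ρ_k = \bar ρ_k |r|^{-(n + ω_k)}` of the `k`-th fluid, the solution with
integration constant `\bar ρ_k` of its conservation law on a brane with spatial metric
`r² σ_{ij}`. -/
def Matter.fluidDensity (F : Matter n d S) (k : Fin (F.k₀ + 1)) (r : ℝ) : ℝ :=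
  F.ρbar k * |r| ^ (-((n : ℤ) + F.w k))

/-- The stress-energy tensor of a perfect fluid, `T^0_0 = -ρ`, `T^i_j = p δ^i_j`,
with its index lowered by the metric `G` of the brane. -/
def fluidStress (G : Matrix (Unit ⊕ Fin n) (Unit ⊕ Fin n) ℝ) (ρ p : ℝ) :
    Matrix (Unit ⊕ Fin n) (Unit ⊕ Fin n) ℝ :=
  G * Matrix.diagonal (Sum.elim (fun _ => -ρ) (fun _ => p))

/-- The stress-energy tensor
`T_{αβ} = (-½ ‖DΦ‖² - V(Φ)) G_{αβ} + g_{AB} Φ^A_α Φ^B_β` of the scalar fields map `Φ`,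
where `‖DΦ‖² = G^{αβ} g_{AB} Φ^A_α Φ^B_β`. -/
def Matter.scalarStress (F : Matter n d S)
    (G : (Unit ⊕ Fin n → ℝ) → Matrix (Unit ⊕ Fin n) (Unit ⊕ Fin n) ℝ)
    (Φ : (Unit ⊕ Fin n → ℝ) → S) (z : Unit ⊕ Fin n → ℝ) :
    Matrix (Unit ⊕ Fin n) (Unit ⊕ Fin n) ℝ :=
  (-(1 / 2) * Matrix.trace ((G z)⁻¹ * F.metric.pullback Φ z) - F.V (Φ z)) • G z
    + F.metric.pullback Φ z

/-- The metric of the brane `t = u(r)` in the chart of `S₀` around `p`. -/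
def braneMetric (B : Bulk n) (g₀ : SemiRiemannianMetric n S₀) (p : S₀) (u : ℝ → ℝ) :
    (Unit ⊕ Fin n → ℝ) → Matrix (Unit ⊕ Fin n) (Unit ⊕ Fin n) ℝ :=
  inducedMetric (B.metric (g₀.components p)) (graphEmbedding n u)

/-- The second fundamental form of the brane `t = u(r)` with respect to its exterior normal, in
the chart of `S₀` around `p`. -/
def braneSecondForm (B : Bulk n) (g₀ : SemiRiemannianMetric n S₀) (p : S₀) (u : ℝ → ℝ) (s : Side)
    (z : Unit ⊕ Fin n → ℝ) : Matrix (Unit ⊕ Fin n) (Unit ⊕ Fin n) ℝ :=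
  secondFundamentalForm (B.metric (g₀.components p)) (graphEmbedding n u)
    (exteriorNormal B u s (z (Sum.inl ()))) z

/-- The total stress-energy tensor of the brane `t = u(r)` with scalar fields `φ(r)`. -/
def totalStress (B : Bulk n) (g₀ : SemiRiemannianMetric n S₀) (F : Matter n d S) (p : S₀)
    (u : ℝ → ℝ) (φ : ℝ → S) (z : Unit ⊕ Fin n → ℝ) :
    Matrix (Unit ⊕ Fin n) (Unit ⊕ Fin n) ℝ :=
  ∑ k, fluidStress (braneMetric B g₀ p u z) (F.fluidDensity k (z (Sum.inl ())))
      ((F.w k : ℝ) / n * F.fluidDensity k (z (Sum.inl ())))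
    + F.scalarStress (braneMetric B g₀ p u) (fun w => φ (w (Sum.inl ()))) z

/-- `(u, φ)` solves the embedding problem for `r ∈ I`, as a brane of position `s`: the graph
`t = u(r)` is a timelike hypersurface in the black (white) hole region, it satisfies the
Israel junction conditions `h_{αβ} - H G_{αβ} = κ (T_{αβ} - σ G_{αβ})`, where `h` is taken with
respect to the exterior normal, and `φ` satisfies the wave equation. -/
structure SolvesEmbedding (B : Bulk n) (g₀ : SemiRiemannianMetric n S₀) (κ : ℝ)
    (F : Matter n d S) (I : Set ℝ) (s : Side) (u : ℝ → ℝ) (φ : ℝ → S) : Prop where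
  region : ∀ r ∈ I, r ≠ 0 ∧ |r| < B.r₀
  smooth_graph : ContDiffOn ℝ ∞ u I
  smooth_field : ContMDiffOn 𝓘(ℝ, ℝ) (𝓡 d) ∞ φ I
  timelike : ∀ r ∈ I, 0 < (B.h r)⁻¹ - B.h r * (deriv u r) ^ 2
  israel : ∀ z : Unit ⊕ Fin n → ℝ, z (Sum.inl ()) ∈ I →
    ∀ p : S₀, (fun i => z (Sum.inr i)) ∈ coordDomain p →
      braneSecondForm B g₀ p u s z
          - Matrix.trace ((braneMetric B g₀ p u z)⁻¹ * braneSecondForm B g₀ p u s z) •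
              braneMetric B g₀ p u z
        = κ • (totalStress B g₀ F p u φ z - F.tension • braneMetric B g₀ p u z)
  wave : ∀ z : Unit ⊕ Fin n → ℝ, z (Sum.inl ()) ∈ I →
    ∀ p : S₀, (fun i => z (Sum.inr i)) ∈ coordDomain p → ∀ A : Fin d,
      F.metric.laplacian (braneMetric B g₀ p u) (fun w => φ (w (Sum.inl ()))) z A
        - F.metric.gradient F.V (φ (z (Sum.inl ()))) A = 0

/-- The velocity `dφ/dr`. -/
def velocity (φ : ℝ → S) (r : ℝ) : TangentSpace (𝓡 d) (φ r) :=
  mfderiv 𝓘(ℝ, ℝ) (𝓡 d) φ r (1 : ℝ)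

/-- The energy density `ρ = -½ ‖Dφ‖² + V(φ) = ½ ‖dφ/dr‖² / (h̃⁻¹ - h̃ |u'|²) + V(φ)` of the scalar
fields on the brane `t = u(r)`. -/
def scalarDensity (B : Bulk n) (F : Matter n d S) (u : ℝ → ℝ) (φ : ℝ → S) (r : ℝ) : ℝ :=
  (1 / 2) * F.metric.val (φ r) (velocity φ r) (velocity φ r)
      / ((B.h r)⁻¹ - B.h r * (deriv u r) ^ 2)
    + F.V (φ r)

/-- A global solution on `(-ε, ε)`: a smooth graph `t = u(r)`, a smooth map `φ` and a smooth vector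
field `χ` along `φ` with `dφ/dr = r^{n-1} χ`, `‖χ(0)‖² > 0` and
`2 κ²/n² ‖χ(0)‖² \bar ρ₀ < 1`, such that the restrictions to `(-ε, 0)` and to `(0, ε)` solve the
embedding problem in the bulk `{r < 0}` and in the reflected bulk `{r > 0}`, respectively, and
`ρ r^{2n}` has a limit greater than `\bar ρ₀` at the singularity. -/
structure IsGlobalSolution (B : Bulk n) (g₀ : SemiRiemannianMetric n S₀) (κ : ℝ)
    (F : Matter n d S) (ε : ℝ) (u : ℝ → ℝ) (φ : ℝ → S)
    (χ : (r : ℝ) → TangentSpace (𝓡 d) (φ r)) : Prop where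
  smooth_graph : ContDiffOn ℝ ∞ u (Ioo (-ε) ε)
  smooth_field : ContMDiffOn 𝓘(ℝ, ℝ) (𝓡 d) ∞ φ (Ioo (-ε) ε)
  smooth_velocity : ContMDiffOn 𝓘(ℝ, ℝ) (𝓡 d).tangent ∞
    (fun r => (⟨φ r, χ r⟩ : TangentBundle (𝓡 d) S)) (Ioo (-ε) ε)
  velocity_eq : ∀ r ∈ Ioo (-ε) ε, velocity φ r = r ^ (n - 1) • χ r
  initial_pos : 0 < F.metric.val (φ 0) (χ 0) (χ 0)
  initial_lt : 2 * (κ ^ 2 / (n : ℝ) ^ 2) * F.metric.val (φ 0) (χ 0) (χ 0) * F.ρbar 0 < 1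
  density_limit : ∃ L, F.ρbar 0 < L ∧
    Tendsto (fun r => scalarDensity B F u φ r * r ^ (2 * n)) (𝓝[≠] 0) (𝓝 L)
  big_crunch : ∃ s, SolvesEmbedding B g₀ κ F (Ioo (-ε) 0) s u φ
  big_bang : ∃ s, SolvesEmbedding B g₀ κ F (Ioo 0 ε) s u φ

end Branes

/-! ## Domains bounded by two branes -/

/-- The hypersurface `{(r, t, x) : t = u(r), r ∈ I}` in `ℝ × ℝ × S₀`. -/
def graphSet (S₀ : Type*) (I : Set ℝ) (u : ℝ → ℝ) : Set (ℝ × ℝ × S₀) :=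
  {q | q.1 ∈ I ∧ q.2.1 = u q.1}

/-- Near each of its points, the graph of `u` over `I` has `Ω` on one side: below it if
`s` is `upper`, above it if `s` is `lower`. -/
def LiesOnSide {S₀ : Type*} [TopologicalSpace S₀] (I : Set ℝ) (Ω : Set (ℝ × ℝ × S₀))
    (u : ℝ → ℝ) (s : Side) : Prop :=
  ∀ q ∈ graphSet S₀ I u, ∀ᶠ q' in 𝓝 q, (q' ∈ Ω ↔ 0 < s.sign * (u q'.1 - q'.2.1))

/-- `Ω` is a domain in `I × ℝ × S₀` that is bounded there by the graphs of `u₁` and `u₂`, which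
have the positions `s₁` and `s₂` with respect to `Ω`. -/
structure IsDomainBoundedBy {S₀ : Type*} [TopologicalSpace S₀] (I : Set ℝ)
    (Ω : Set (ℝ × ℝ × S₀)) (u₁ : ℝ → ℝ) (s₁ : Side) (u₂ : ℝ → ℝ) (s₂ : Side) : Prop where
  isOpen : IsOpen Ω
  isConnected : IsConnected Ω
  subset : ∀ q ∈ Ω, q.1 ∈ I
  boundary : frontier Ω ∩ {q | q.1 ∈ I} = graphSet S₀ I u₁ ∪ graphSet S₀ I u₂
  side₁ : LiesOnSide I Ω u₁ s₁
  side₂ : LiesOnSide I Ω u₂ s₂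

/-- The configuration `(Ω, N₁, N₂)` for `r ∈ I`: `Ω` is a domain that is bounded by the branes
`N_i = {t = u_i(r)}`, and each `N_i` solves the embedding problem as a boundary
brane of `Ω`, i.e., with the normal exterior to `Ω`. -/
structure IsConfiguration {n d₁ d₂ : ℕ}
    {S₀ : Type*} [TopologicalSpace S₀] [ChartedSpace (EuclideanSpace ℝ (Fin n)) S₀]
    [IsManifold (𝓡 n) ∞ S₀]
    {S₁ : Type*} [TopologicalSpace S₁] [ChartedSpace (EuclideanSpace ℝ (Fin d₁)) S₁]
    [IsManifold (𝓡 d₁) ∞ S₁]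
    {S₂ : Type*} [TopologicalSpace S₂] [ChartedSpace (EuclideanSpace ℝ (Fin d₂)) S₂]
    [IsManifold (𝓡 d₂) ∞ S₂]
    (B : Bulk n) (g₀ : SemiRiemannianMetric n S₀) (κ : ℝ)
    (F₁ : Matter n d₁ S₁) (F₂ : Matter n d₂ S₂) (I : Set ℝ) (Ω : Set (ℝ × ℝ × S₀))
    (u₁ : ℝ → ℝ) (φ₁ : ℝ → S₁) (s₁ : Side) (u₂ : ℝ → ℝ) (φ₂ : ℝ → S₂) (s₂ : Side) : Prop where
  domain : IsDomainBoundedBy I Ω u₁ s₁ u₂ s₂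
  brane₁ : SolvesEmbedding B g₀ κ F₁ I s₁ u₁ φ₁
  brane₂ : SolvesEmbedding B g₀ κ F₂ I s₂ u₂ φ₂

end BraneWorld

end

open BraneWorld

/-! Everything rests on the radial component of the Israel conditions, `n ν^r / r = κ (ρ + σ)`, with
`ρ` the total energy density. Its left side has the sign of `s r u'`, where `s = ±1` is the position
of the brane. Near the singularity the scalar density grows like `r^{-2n}` and dominates the
tension, while the fluids contribute nonnegatively, so the right side has the sign of `κ`. Hence `s
κ r u' > 0` on both sides of `r = 0`.

The same equation shows that the brane is almost lightlike: the growth of the density forces `1/2 ≤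
(h̃ u')² ≤ 1`, and since `h̃` is comparable to `|r|^{-(n-1)}`, `|u'|` is comparable to `|r|^{n-1}`
(`SolvesEmbedding.speed_near_singularity`). As `u` is smooth across `0`, Taylor's formula turns this
into a nonzero limit of `u' / r^{n-1}` (`exists_tendsto_div_pow`). For odd `n` the power `r^{n-1}`
is even, so `u'` has one and the same sign before and after the singularity. Since `r` changes sign
and `s κ r u'` does not, `s` must change: upper branes become lower and conversely
(`IsGlobalSolution.side_switch`).

A domain with an upper and a lower boundary graph is the region between them
(`IsDomainBoundedBy.eq_band`), so domains are the same as inequalities between `u₁` and `u₂`. Before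
the singularity `u₂ < u₁`; a reflected domain requires `u₁ < u₂`, and continuity gives `u₁ 0 = u₂
0`. Conversely, `κ (u₁ - u₂)` is strictly decreasing near `0`, so colliding branes cross there and
bound a domain afterwards. Translation in `t` preserves all equations because the bulk metric does
not depend on `t`. -/

namespace BraneWorld

/-! ### Nondegeneracy of the metric components -/

section Components

variable {d : ℕ} {M : Type*} [TopologicalSpace M] [ChartedSpace (EuclideanSpace ℝ (Fin d)) M]

theorem coords_mem_coordDomain (p : M) : coords (d := d) p p ∈ coordDomain (d := d) p := by
  simp [coordDomain, coords]

variable [IsManifold (𝓡 d) ∞ M]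

/-- Bilinearity, by expanding in the standard basis. It turns a kernel vector of the component
matrix into a tangent vector of length zero. -/
theorem dotProduct_mulVec_bilin {E : Type*} [NormedAddCommGroup E] [NormedSpace ℝ E]
    (b : E →L[ℝ] E →L[ℝ] ℝ) (D : EuclideanSpace ℝ (Fin d) →L[ℝ] E) (v : Fin d → ℝ) :
    v ⬝ᵥ (Matrix.of fun i j => b (D (EuclideanSpace.single i (1 : ℝ)))
      (D (EuclideanSpace.single j (1 : ℝ)))).mulVec v
      = b (D (WithLp.toLp 2 v)) (D (WithLp.toLp 2 v)) := by
  have hsum : WithLp.toLp 2 v = ∑ i, v i • EuclideanSpace.single i (1 : ℝ) := by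
    ext j; simp [Finset.sum_apply, Pi.single_apply]
  simp only [hsum, map_sum, map_smul, dotProduct, Matrix.mulVec, Matrix.of_apply, Finset.mul_sum,
    sum_apply, smul_apply, smul_eq_mul]
  refine (Finset.sum_congr rfl fun i _ => Finset.sum_congr rfl fun j _ => ?_).trans
    Finset.sum_comm
  ring

/-- The components of a Riemannian metric form an invertible matrix. -/
theorem SemiRiemannianMetric.IsRiemannian.det_components_ne_zero {g : SemiRiemannianMetric d M}
    (hg : g.IsRiemannian) {p : M} {x : Fin d → ℝ} (hx : x ∈ coordDomain p) :
    (g.components p x).det ≠ 0 := by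
  intro h0
  obtain ⟨v, hv, hv0⟩ := Matrix.exists_mulVec_eq_zero_iff.2 h0
  have hinv := isInvertible_mfderivWithin_extChartAt_symm (I := 𝓡 d) (x := p)
    (show WithLp.toLp 2 x ∈ (extChartAt (𝓡 d) p).target from hx)
  rw [ModelWithCorners.range_eq_univ, mfderivWithin_univ] at hinv
  set D := mfderiv 𝓘(ℝ, EuclideanSpace ℝ (Fin d)) (𝓡 d) (extChartAt (𝓡 d) p).symm
    (WithLp.toLp 2 x) with hD
  have hne : D (WithLp.toLp 2 v) ≠ 0 := by
    intro h
    have := hinv.injective (h.trans (map_zero D).symm)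
    apply hv
    ext j
    exact congrArg (fun w : EuclideanSpace ℝ (Fin d) => w j) this
  have hpos := hg _ _ hne
  have : g.val (point p x) (D (WithLp.toLp 2 v)) (D (WithLp.toLp 2 v)) = 0 := by
    have h1 : v ⬝ᵥ (g.components p x).mulVec v = 0 := by rw [hv0]; simp
    exact (dotProduct_mulVec_bilin (E := EuclideanSpace ℝ (Fin d)) (g.val (point p x)) D v).symm.trans h1
  exact hpos.ne' this

end Components

/-! ### Geometry of the graph `t = u(r)` -/

section Geometry

variable {n d : ℕ}
  {S₀ : Type*} [TopologicalSpace S₀] [ChartedSpace (EuclideanSpace ℝ (Fin n)) S₀]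
  [IsManifold (𝓡 n) ∞ S₀]
  {S : Type*} [TopologicalSpace S] [ChartedSpace (EuclideanSpace ℝ (Fin d)) S]
  [IsManifold (𝓡 d) ∞ S]

section PartialDerivatives

variable {ι : Type} [DecidableEq ι]

@[simp]
theorem pd_const (i : ι) (c : ℝ) (z : ι → ℝ) : pd i (fun _ => c) z = 0 := by
  simp [pd]

theorem pd_coord (i j : ι) (z : ι → ℝ) : pd i (fun w => w j) z = if i = j then 1 else 0 := by
  by_cases h : i = j
  · subst h; simp [pd]
  · simp [pd, h, Function.update_of_ne (Ne.symm h)]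

theorem pd_comp_coord (f : ℝ → ℝ) (i j : ι) (z : ι → ℝ) :
    pd i (fun w => f (w j)) z = if i = j then deriv f (z j) else 0 := by
  by_cases h : i = j
  · subst h; simp [pd]
  · simp [pd, h, Function.update_of_ne (Ne.symm h)]

end PartialDerivatives

theorem braneMetric_eq (B : Bulk n) (g₀ : SemiRiemannianMetric n S₀) (p : S₀) (u : ℝ → ℝ)
    (z : Unit ⊕ Fin n → ℝ) :
    braneMetric B g₀ p u z = Matrix.fromBlocks
      (Matrix.of fun _ _ => -((B.h (z (Sum.inl ())))⁻¹
        - B.h (z (Sum.inl ())) * deriv u (z (Sum.inl ())) ^ 2)) 0 0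
      (z (Sum.inl ()) ^ 2 • g₀.components p (fun i => z (Sum.inr i))) := by
  ext a b
  rcases a with a | a <;> rcases b with b | b <;>
    simp [braneMetric, inducedMetric, graphEmbedding, Bulk.metric, pd_coord, pd_comp_coord,
      Fintype.sum_sum_type, Fin.sum_univ_two]
  ring

/-- The embedding is affine in `x`, so its second spatial derivatives vanish, and `ν` has no spatial
components. Only `Γ_{r,ij} = -r σ_{ij}` survives, since `Γ_{t,ij} = 0`; no second derivative of `u`
appears. -/
theorem braneSecondForm_inr (B : Bulk n) (g₀ : SemiRiemannianMetric n S₀) (p : S₀) (u : ℝ → ℝ)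
    (s : Side) (z : Unit ⊕ Fin n → ℝ) (i j : Fin n) :
    braneSecondForm B g₀ p u s z (Sum.inr i) (Sum.inr j) =
      z (Sum.inl ()) * exteriorNormal B u s (z (Sum.inl ())) (Sum.inl 0)
        * g₀.components p (fun i => z (Sum.inr i)) i j := by
  have hr : pd (Sum.inl 0 : Fin 2 ⊕ Fin n)
      (fun w => w (Sum.inl 0) ^ 2 * g₀.components p (fun i => w (Sum.inr i)) i j)
      (graphEmbedding n u z) = 2 * z (Sum.inl ()) * g₀.components p (fun i => z (Sum.inr i)) i j := by
    simp [pd, graphEmbedding, Function.update]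
  have ht : pd (Sum.inl 1 : Fin 2 ⊕ Fin n)
      (fun w => w (Sum.inl 0) ^ 2 * g₀.components p (fun i => w (Sum.inr i)) i j)
      (graphEmbedding n u z) = 0 := by
    simp [pd, Function.update]
  have hy : ∀ c : Fin 2 ⊕ Fin n, pd (Sum.inr i)
      (pd (Sum.inr j) (fun w => graphEmbedding n u w c)) z = 0 := by
    intro c
    have hc : pd (Sum.inr j : Unit ⊕ Fin n) (fun w => graphEmbedding n u w c)
        = fun _ => if Sum.inr j = c then 1 else 0 := by
      ext w
      rcases c with c | c
      · fin_cases c <;> simp [graphEmbedding, pd_coord, pd_comp_coord]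
      · simp [graphEmbedding, pd_coord]
    rw [hc, pd_const]
  have hy' : ∀ (k : Fin n) (c : Fin 2 ⊕ Fin n),
      pd (Sum.inr k) (fun w => graphEmbedding n u w c) z = if Sum.inr k = c then 1 else 0 := by
    intro k c
    rcases c with c | c
    · fin_cases c <;> simp [graphEmbedding, pd_coord, pd_comp_coord]
    · simp [graphEmbedding, pd_coord]
  have hΓr : christoffelLow (B.metric (g₀.components p)) (graphEmbedding n u z) (Sum.inl 0)
      (Sum.inr i) (Sum.inr j) = -(z (Sum.inl ()) * g₀.components p (fun i => z (Sum.inr i)) i j) := by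
    simp only [christoffelLow, Bulk.metric, Matrix.fromBlocks_apply₁₂, Matrix.fromBlocks_apply₂₂,
      Matrix.zero_apply, pd_const, Matrix.smul_apply, smul_eq_mul, hr]
    ring
  have hΓt : christoffelLow (B.metric (g₀.components p)) (graphEmbedding n u z) (Sum.inl 1)
      (Sum.inr i) (Sum.inr j) = 0 := by
    simp only [christoffelLow, Bulk.metric, Matrix.fromBlocks_apply₁₂, Matrix.fromBlocks_apply₂₂,
      Matrix.zero_apply, pd_const, Matrix.smul_apply, smul_eq_mul, ht]
    ring
  have hν : ∀ k : Fin n, exteriorNormal B u s (z (Sum.inl ())) (Sum.inr k) = 0 := fun k => rfl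
  simp only [braneSecondForm, secondFundamentalForm, Matrix.of_apply, hy, hy', mul_zero,
    Finset.sum_const_zero, zero_add, mul_ite, mul_one]
  simp only [Finset.sum_ite_eq, Finset.mem_univ, if_true, Fintype.sum_sum_type, Fin.sum_univ_two,
    Finset.sum_const_zero, add_zero, hν, mul_zero, hΓr, hΓt]
  ring

/-! ### Invariance under translation in `t` -/

section Translation

theorem braneMetric_translate (B : Bulk n) (g₀ : SemiRiemannianMetric n S₀) (p : S₀) (u : ℝ → ℝ)
    (c : ℝ) : braneMetric B g₀ p (fun r => u r + c) = braneMetric B g₀ p u := by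
  ext1 z
  simp only [braneMetric_eq, deriv_add_const]

theorem exteriorNormal_translate (B : Bulk n) (u : ℝ → ℝ) (s : Side) (c r : ℝ) :
    exteriorNormal B (fun r => u r + c) s r = exteriorNormal B u s r := by
  simp only [exteriorNormal, deriv_add_const]

/-- Applied with `j` the time coordinate, this passes from the `t`-independence of the bulk metric
to that of its Christoffel symbols. -/
theorem pd_update_of_invariant {ι : Type} [DecidableEq ι] {f : (ι → ℝ) → ℝ} {j : ι}
    (hf : ∀ w t, f (Function.update w j t) = f w) (i : ι) (z : ι → ℝ) (t : ℝ) :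
    pd i f (Function.update z j t) = pd i f z := by
  by_cases h : i = j
  · subst h; simp [pd, hf]
  · simp only [pd, Function.update_of_ne h]
    congr 1
    ext s
    rw [Function.update_comm (Ne.symm h), hf]

theorem Bulk.metric_update_time (B : Bulk n) (Q : (Fin n → ℝ) → Matrix (Fin n) (Fin n) ℝ)
    (z : Fin 2 ⊕ Fin n → ℝ) (t : ℝ) :
    B.metric Q (Function.update z (Sum.inl 1) t) = B.metric Q z := by
  simp [Bulk.metric]

theorem Bulk.christoffelLow_update_time (B : Bulk n)
    (Q : (Fin n → ℝ) → Matrix (Fin n) (Fin n) ℝ)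
    (z : Fin 2 ⊕ Fin n → ℝ) (t : ℝ) :
    christoffelLow (B.metric Q) (Function.update z (Sum.inl 1) t) = christoffelLow (B.metric Q) z := by
  ext a b c
  have h : ∀ i j k : Fin 2 ⊕ Fin n, pd i (fun w => B.metric Q w j k)
      (Function.update z (Sum.inl 1) t) = pd i (fun w => B.metric Q w j k) z := fun i j k =>
    pd_update_of_invariant (fun w t => by rw [Bulk.metric_update_time]) i z t
  simp only [christoffelLow, h]

theorem graphEmbedding_translate (u : ℝ → ℝ) (c : ℝ) (z : Unit ⊕ Fin n → ℝ) :
    graphEmbedding n (fun r => u r + c) z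
      = Function.update (graphEmbedding n u z) (Sum.inl 1) (u (z (Sum.inl ())) + c) := by
  ext a
  rcases a with a | a
  · fin_cases a <;> simp [graphEmbedding]
  · simp [graphEmbedding]

theorem pd_graphEmbedding_translate (u : ℝ → ℝ) (c : ℝ) (a : Unit ⊕ Fin n) (b : Fin 2 ⊕ Fin n) :
    pd a (fun w => graphEmbedding n (fun r => u r + c) w b)
      = pd a (fun w => graphEmbedding n u w b) := by
  ext z
  rcases b with b | b
  · fin_cases b
    · simp [graphEmbedding]
    · simp [graphEmbedding, pd]
  · simp [graphEmbedding]

theorem braneSecondForm_translate (B : Bulk n) (g₀ : SemiRiemannianMetric n S₀) (p : S₀)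
    (u : ℝ → ℝ) (s : Side) (c : ℝ) :
    braneSecondForm B g₀ p (fun r => u r + c) s = braneSecondForm B g₀ p u s := by
  ext z a b
  simp only [braneSecondForm, secondFundamentalForm, Matrix.of_apply, exteriorNormal_translate,
    pd_graphEmbedding_translate]
  simp only [graphEmbedding_translate u c z, Bulk.metric_update_time,
    Bulk.christoffelLow_update_time]

theorem totalStress_translate (B : Bulk n) (g₀ : SemiRiemannianMetric n S₀) (F : Matter n d S)
    (p : S₀) (u : ℝ → ℝ) (φ : ℝ → S) (c : ℝ) :
    totalStress B g₀ F p (fun r => u r + c) φ = totalStress B g₀ F p u φ := by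
  ext1 z
  simp only [totalStress, braneMetric_translate]

/-- Translation is an isometry of the bulk: `u` enters the equations only through `u'` and through
bulk quantities that do not depend on `t`. -/
theorem SolvesEmbedding.translate {B : Bulk n} {g₀ : SemiRiemannianMetric n S₀} {κ : ℝ}
    {F : Matter n d S} {I : Set ℝ} {s : Side} {u : ℝ → ℝ} {φ : ℝ → S}
    (h : SolvesEmbedding B g₀ κ F I s u φ) (c : ℝ) :
    SolvesEmbedding B g₀ κ F I s (fun r => u r + c) φ where
  region := h.region
  smooth_graph := h.smooth_graph.add contDiffOn_const
  smooth_field := h.smooth_field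
  timelike := by simpa only [deriv_add_const] using h.timelike
  israel := by
    simpa only [braneMetric_translate, braneSecondForm_translate, totalStress_translate]
      using h.israel
  wave := by simpa only [braneMetric_translate] using h.wave

theorem SolvesEmbedding.mono {B : Bulk n} {g₀ : SemiRiemannianMetric n S₀} {κ : ℝ}
    {F : Matter n d S} {I J : Set ℝ} {s : Side} {u : ℝ → ℝ} {φ : ℝ → S}
    (h : SolvesEmbedding B g₀ κ F I s u φ) (hJ : J ⊆ I) : SolvesEmbedding B g₀ κ F J s u φ where
  region r hr := h.region r (hJ hr)
  smooth_graph := h.smooth_graph.mono hJ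
  smooth_field := h.smooth_field.mono hJ
  timelike r hr := h.timelike r (hJ hr)
  israel z hz := h.israel z (hJ hz)
  wave z hz := h.wave z (hJ hz)

theorem IsGlobalSolution.translate {B : Bulk n} {g₀ : SemiRiemannianMetric n S₀} {κ : ℝ}
    {F : Matter n d S} {ε : ℝ} {u : ℝ → ℝ} {φ : ℝ → S}
    {χ : (r : ℝ) → TangentSpace (𝓡 d) (φ r)}
    (h : IsGlobalSolution B g₀ κ F ε u φ χ) (c : ℝ) :
    IsGlobalSolution B g₀ κ F ε (fun r => u r + c) φ χ where
  smooth_graph := h.smooth_graph.add contDiffOn_const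
  smooth_field := h.smooth_field
  smooth_velocity := h.smooth_velocity
  velocity_eq := h.velocity_eq
  initial_pos := h.initial_pos
  initial_lt := h.initial_lt
  density_limit := by simpa only [scalarDensity, deriv_add_const] using h.density_limit
  big_crunch := h.big_crunch.imp fun _ hs => hs.translate c
  big_bang := h.big_bang.imp fun _ hs => hs.translate c

end Translation

/-! ### The radial Israel condition -/

section Israel

/-- The fields depend on `r` alone, so by the chain rule their differential factors through the
projection to `r` and kills the spatial directions. -/
theorem pullback_comp_radial (g : SemiRiemannianMetric d S) {φ : ℝ → S}
    {z : Unit ⊕ Fin n → ℝ} (hφ : MDifferentiableAt 𝓘(ℝ, ℝ) (𝓡 d) φ (z (Sum.inl ()))) :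
    g.pullback (fun w : Unit ⊕ Fin n → ℝ => φ (w (Sum.inl ()))) z = Matrix.fromBlocks
      (Matrix.of fun _ _ =>
        g.val (φ (z (Sum.inl ()))) (velocity φ (z (Sum.inl ()))) (velocity φ (z (Sum.inl ())))) 0 0 0
    := by
  have hproj : HasMFDerivAt 𝓘(ℝ, Unit ⊕ Fin n → ℝ) 𝓘(ℝ, ℝ)
      (fun w : Unit ⊕ Fin n → ℝ => w (Sum.inl ())) z
      (ContinuousLinearMap.proj (R := ℝ) (φ := fun _ : Unit ⊕ Fin n => ℝ) (Sum.inl ())) :=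
    (ContinuousLinearMap.hasFDerivAt (ContinuousLinearMap.proj (R := ℝ)
      (φ := fun _ : Unit ⊕ Fin n => ℝ) (Sum.inl ()))).hasMFDerivAt
  have hD : ∀ v : Unit ⊕ Fin n → ℝ,
      mfderiv 𝓘(ℝ, Unit ⊕ Fin n → ℝ) (𝓡 d)
        (fun w : Unit ⊕ Fin n → ℝ => φ (w (Sum.inl ()))) z v
        = mfderiv 𝓘(ℝ, ℝ) (𝓡 d) φ (z (Sum.inl ())) (v (Sum.inl ())) := by
    intro v
    have := (HasMFDerivAt.comp z hφ.hasMFDerivAt hproj).mfderiv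
    exact congrArg (fun L => L v) this
  have h0 : ∀ i : Fin n, mfderiv 𝓘(ℝ, Unit ⊕ Fin n → ℝ) (𝓡 d)
        (fun w : Unit ⊕ Fin n → ℝ => φ (w (Sum.inl ()))) z (Pi.single (Sum.inr i) (1 : ℝ)) = 0 := by
    intro i
    rw [hD, Pi.single_eq_of_ne (by simp)]
    exact map_zero _
  have h1 : mfderiv 𝓘(ℝ, Unit ⊕ Fin n → ℝ) (𝓡 d)
        (fun w : Unit ⊕ Fin n → ℝ => φ (w (Sum.inl ()))) z (Pi.single (Sum.inl ()) (1 : ℝ))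
        = velocity φ (z (Sum.inl ())) := by
    rw [hD, Pi.single_eq_same]; rfl
  ext a b
  rcases a with a | a <;> rcases b with b | b <;>
    simp [SemiRiemannianMetric.pullback, h0, h1]

/-- The trace of `G⁻¹ A` for a block diagonal `G` with a one-dimensional first block. -/
theorem trace_inv_fromBlocks_mul {a : ℝ} (ha : a ≠ 0) {Q : Matrix (Fin n) (Fin n) ℝ}
    (hQ : IsUnit Q) (A : Matrix (Unit ⊕ Fin n) (Unit ⊕ Fin n) ℝ) :
    Matrix.trace ((Matrix.fromBlocks (Matrix.of fun _ _ => a) 0 0 Q)⁻¹ * A)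
      = a⁻¹ * A (Sum.inl ()) (Sum.inl ()) + Matrix.trace (Q⁻¹ * A.toBlocks₂₂) := by
  have hA : (Matrix.of fun _ _ : Unit => a) = Matrix.diagonal fun _ => a := by
    ext i j; simp [Matrix.diagonal]
  have hAi : (Matrix.of fun _ _ : Unit => a)⁻¹ = Matrix.diagonal fun _ => a⁻¹ :=
    Matrix.inv_eq_right_inv (by rw [hA, Matrix.diagonal_mul_diagonal]; simp [ha])
  have hU : IsUnit (Matrix.of fun _ _ : Unit => a) := by
    rw [hA, Matrix.isUnit_diagonal, Pi.isUnit_iff]; exact fun _ => ha.isUnit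
  rw [Matrix.inv_fromBlocks_zero₂₁_of_isUnit_iff _ _ _ (iff_of_true hU hQ)]
  conv_lhs => rw [← Matrix.fromBlocks_toBlocks A]
  rw [Matrix.fromBlocks_multiply, hAi]
  simp [Matrix.trace, Matrix.toBlocks₁₁]

/-- The radial component of the Israel junction condition, `n ν^r / r = κ (ρ + σ)`. -/
theorem SolvesEmbedding.israel_radial [Nonempty S₀] {B : Bulk n} {g₀ : SemiRiemannianMetric n S₀}
    (hg₀ : g₀.IsRiemannian) {κ : ℝ} {F : Matter n d S} {I : Set ℝ} (hI : IsOpen I) {s : Side}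
    {u : ℝ → ℝ} {φ : ℝ → S} (h : SolvesEmbedding B g₀ κ F I s u φ) {r : ℝ} (hr : r ∈ I) :
    (n : ℝ) * (exteriorNormal B u s r (Sum.inl 0) / r)
      = κ * (∑ k, F.fluidDensity k r + scalarDensity B F u φ r + F.tension) := by
  obtain ⟨p⟩ := ‹Nonempty S₀›
  have hr0 : r ≠ 0 := (h.region r hr).1
  set z : Unit ⊕ Fin n → ℝ := Sum.elim (fun _ => r) (coords p p) with hz
  have hzr : z (Sum.inl ()) = r := rfl
  have hzx : (fun i => z (Sum.inr i)) = coords p p := rfl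
  have hx := coords_mem_coordDomain (d := n) p
  set w := (B.h r)⁻¹ - B.h r * deriv u r ^ 2 with hw
  have hwpos : 0 < w := h.timelike r hr
  set Q := g₀.components p (coords p p) with hQ
  have hrQ : IsUnit (r ^ 2 • Q) := by
    rw [Matrix.isUnit_iff_isUnit_det, Matrix.det_smul]
    exact ((pow_ne_zero _ (pow_ne_zero _ hr0)).isUnit).mul
      (hg₀.det_components_ne_zero hx).isUnit
  have hG : braneMetric B g₀ p u z = Matrix.fromBlocks (Matrix.of fun _ _ => -w) 0 0 (r ^ 2 • Q) :=
    braneMetric_eq B g₀ p u z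
  have hφ : MDifferentiableAt 𝓘(ℝ, ℝ) (𝓡 d) φ (z (Sum.inl ())) :=
    (h.smooth_field.contMDiffAt (hI.mem_nhds hr)).mdifferentiableAt (by simp)
  have hP : F.metric.pullback (fun w => φ (w (Sum.inl ()))) z = Matrix.fromBlocks
      (Matrix.of fun _ _ => F.metric.val (φ r) (velocity φ r) (velocity φ r)) 0 0 0 :=
    pullback_comp_radial F.metric hφ
  have hblock : (braneSecondForm B g₀ p u s z).toBlocks₂₂
      = (exteriorNormal B u s r (Sum.inl 0) / r) • (r ^ 2 • Q) := by
    ext i j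
    simp only [Matrix.toBlocks₂₂, Matrix.of_apply, braneSecondForm_inr, Matrix.smul_apply,
      smul_eq_mul, hzr, hzx, ← hQ]
    field_simp
  have htr : Matrix.trace ((r ^ 2 • Q)⁻¹ * (braneSecondForm B g₀ p u s z).toBlocks₂₂)
      = n * (exteriorNormal B u s r (Sum.inl 0) / r) := by
    rw [hblock, Matrix.mul_smul, Matrix.nonsing_inv_mul _ ((Matrix.isUnit_iff_isUnit_det _).1 hrQ),
      Matrix.trace_smul, Matrix.trace_one]
    simp [mul_comm]
  -- With `G_{rr} = -w`, the trace is `H = -h_{rr} / w + n ν^r / r`. In `h_{rr} - H G_{rr}` the term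
  -- `h_{rr}`, the only one with `u''`, cancels, and `w n ν^r / r` remains.
  have key := congrArg (fun A => A (Sum.inl ()) (Sum.inl ())) (h.israel z hr p hx)
  simp only [Matrix.sub_apply, Matrix.smul_apply, totalStress, Matrix.add_apply, fluidStress,
    Matter.scalarStress, hG, hP, hzr, Matrix.sum_apply,
    trace_inv_fromBlocks_mul (neg_ne_zero.2 hwpos.ne') hrQ, htr, Matrix.mul_diagonal,
    Matrix.fromBlocks_apply₁₁, Matrix.of_apply, Matrix.toBlocks_fromBlocks₂₂, Matrix.mul_zero,
    Matrix.trace_zero, smul_eq_mul, Sum.elim_inl, add_zero] at key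
  rw [← Finset.mul_sum, Finset.sum_neg_distrib] at key
  rw [scalarDensity, ← hw]
  field_simp at key ⊢
  linear_combination key

end Israel

end Geometry

/-! ### Leading coefficients of smooth functions -/

section Calculus

/-- Letting `x → 0` kills the constant term; dividing by `x` then lowers the degree and the order of
the bound by one. -/
theorem sum_pow_eq_of_eventually_le (k : ℕ) (a : ℕ → ℝ) (C : ℝ)
    (h : ∀ᶠ x in 𝓝[≠] (0 : ℝ), |∑ j ∈ Finset.range (k + 1), a j * x ^ j| ≤ C * |x| ^ k) (x : ℝ) :
    ∑ j ∈ Finset.range (k + 1), a j * x ^ j = a k * x ^ k := by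
  induction k generalizing a x with
  | zero => simp
  | succ k ih =>
    have hsum : ∀ y, ∑ j ∈ Finset.range (k + 1 + 1), a j * y ^ j
        = (∑ j ∈ Finset.range (k + 1), a (j + 1) * y ^ j) * y + a 0 := by
      intro y
      rw [Finset.sum_range_succ', Finset.sum_mul]
      simp [pow_succ, mul_assoc]
    have h0 : a 0 = 0 := by
      have hc : Continuous fun y : ℝ => ∑ j ∈ Finset.range (k + 1 + 1), a j * y ^ j := by fun_prop
      have h1 : Tendsto (fun y : ℝ => |∑ j ∈ Finset.range (k + 1 + 1), a j * y ^ j|) (𝓝[≠] 0)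
          (𝓝 |a 0|) := by
        have := (hc.abs.tendsto 0).mono_left (nhdsWithin_le_nhds (s := {0}ᶜ))
        simpa [hsum] using this
      have h2 : Tendsto (fun y : ℝ => C * |y| ^ (k + 1)) (𝓝[≠] 0) (𝓝 0) := by
        have hc' : Continuous fun y : ℝ => C * |y| ^ (k + 1) := by fun_prop
        simpa using (hc'.tendsto 0).mono_left (nhdsWithin_le_nhds (s := {0}ᶜ))
      exact abs_nonpos_iff.1 (le_of_tendsto_of_tendsto h1 h2 h)
    rw [hsum, h0, ih (fun j => a (j + 1))]
    · ring
    · filter_upwards [h, self_mem_nhdsWithin] with y hy hy0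
      rw [hsum, h0, add_zero, abs_mul, pow_succ, ← mul_assoc] at hy
      exact le_of_mul_le_mul_right hy (abs_pos.2 hy0)

/-- A smooth function that is comparable to `|x|ᵏ` near `0` has a leading coefficient. -/
theorem exists_tendsto_div_pow {f : ℝ → ℝ} {ε a A : ℝ} {k : ℕ} (hε : 0 < ε) (ha : 0 < a)
    (hf : ContDiffOn ℝ k f (Ioo (-ε) ε))
    (hb : ∀ᶠ x in 𝓝[≠] (0 : ℝ), a * |x| ^ k ≤ |f x| ∧ |f x| ≤ A * |x| ^ k) :
    ∃ l ≠ 0, Tendsto (fun x => f x / x ^ k) (𝓝[≠] 0) (𝓝 l) := by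
  have h0 : (0 : ℝ) ∈ Ioo (-ε) ε := by simpa using hε
  have hT := taylor_isLittleO (convex_Ioo (-ε) ε) h0 hf
  rw [nhdsWithin_eq_nhds.2 (isOpen_Ioo.mem_nhds h0)] at hT
  set b : ℕ → ℝ := fun j => ((j.factorial : ℝ))⁻¹ * iteratedDerivWithin j f (Ioo (-ε) ε) 0 with hbdef
  have hTay : ∀ x, taylorWithinEval f k (Ioo (-ε) ε) 0 x
      = ∑ j ∈ Finset.range (k + 1), b j * x ^ j := by
    intro x
    rw [taylor_within_apply]
    refine Finset.sum_congr rfl fun j _ => ?_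
    simp only [hbdef, sub_zero, smul_eq_mul]
    ring
  simp only [hTay, sub_zero] at hT
  have hT' := hT.mono (nhdsWithin_le_nhds (s := ({0} : Set ℝ)ᶜ))
  -- The Taylor polynomial differs from `f` by `o(x^k)`, so it inherits the bound `O(|x|^k)`, with
  -- constant `A + 1`, and reduces to its top monomial.
  have hp : ∀ x, ∑ j ∈ Finset.range (k + 1), b j * x ^ j = b k * x ^ k := by
    refine sum_pow_eq_of_eventually_le k b (A + 1) ?_
    filter_upwards [hT'.def one_pos, hb] with x hx hx'
    rw [Real.norm_eq_abs, Real.norm_eq_abs, abs_pow, one_mul] at hx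
    have := abs_sub_abs_le_abs_sub (∑ j ∈ Finset.range (k + 1), b j * x ^ j) (f x)
    rw [abs_sub_comm] at this
    linarith [hx'.2]
  simp only [hp] at hT'
  have hlim : Tendsto (fun x => f x / x ^ k) (𝓝[≠] 0) (𝓝 (b k)) := by
    have h1 := hT'.tendsto_div_nhds_zero.add_const (b k)
    rw [zero_add] at h1
    refine h1.congr' ?_
    filter_upwards [self_mem_nhdsWithin] with x hx
    have : x ^ k ≠ 0 := pow_ne_zero _ hx
    field_simp
    ring
  refine ⟨b k, ?_, hlim⟩
  -- The lower bound on `|f|` survives in the limit and keeps the leading coefficient away from `0`.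
  have hle : a ≤ |b k| := by
    refine ge_of_tendsto hlim.abs ?_
    filter_upwards [hb, self_mem_nhdsWithin] with x hx hx0
    rw [abs_div, abs_pow, le_div_iff₀ (pow_pos (abs_pos.2 hx0) _)]
    exact hx.1
  exact abs_pos.1 (ha.trans_le hle)

end Calculus

/-! ### The function `h̃` near the singularity -/

section Warp

variable {n : ℕ}

theorem Bulk.h_pos (B : Bulk n) {r : ℝ} (h0 : r ≠ 0) (hr : |r| < B.r₀) : 0 < B.h r := by
  have := B.warp_pos |r| (abs_pos.2 h0) hr
  simpa [Bulk.h, warp] using this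

/-- Near the singularity `h̃` is comparable to `|r|^{-(n-1)}`. -/
theorem Bulk.exists_tendsto_h_mul_pow (hn : Odd n) (B : Bulk n) :
    ∃ M, 0 < M ∧ Tendsto (fun r => B.h r * r ^ (n - 1)) (𝓝[≠] 0) (𝓝 M) := by
  have hlim : Tendsto (fun r => B.h r * r ^ (n - 1)) (𝓝[≠] 0)
      (𝓝 (B.m - B.curv * 0 ^ (n - 1))) := by
    have hc : Continuous fun r : ℝ =>
        B.m + (2 / ((n : ℝ) * ((n : ℝ) + 1)) * B.Λ * r ^ 2 - B.curv) * r ^ (n - 1) := by fun_prop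
    have h1 := (hc.tendsto 0).mono_left (nhdsWithin_le_nhds (s := {0}ᶜ))
    have h2 : B.m + (2 / ((n : ℝ) * ((n : ℝ) + 1)) * B.Λ * 0 ^ 2 - B.curv) * 0 ^ (n - 1)
        = B.m - B.curv * 0 ^ (n - 1) := by ring
    rw [h2] at h1
    refine h1.congr' ?_
    filter_upwards [self_mem_nhdsWithin] with r hr
    have : r ^ (n - 1) ≠ 0 := pow_ne_zero _ hr
    rw [Bulk.h, warp, (Nat.Odd.sub_odd hn odd_one).pow_abs]
    field_simp
    ring
  refine ⟨_, ?_, hlim⟩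
  rcases eq_or_ne n 1 with rfl | hn1
  -- For `n = 1` the factor `r^{n-1}` is `1` and the limit is `m - κ̃`. Its positivity comes from
  -- the horizon: `h̃(r₀/2) - h̃(r₀)/4 = (3/4) (m - κ̃)`.
  · have h0 := B.warp_horizon
    have h1 := B.warp_pos (B.r₀ / 2) (half_pos B.r₀_pos) (half_lt_self B.r₀_pos)
    simp only [warp, Nat.sub_self, pow_zero] at h0 h1
    have := sq_pos_of_pos B.r₀_pos
    norm_num at h0 h1 ⊢
    nlinarith
  · have : n - 1 ≠ 0 := by have := hn.pos; omega
    rw [zero_pow this]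
    simpa using B.m_pos

end Warp

/-- The radial Israel condition, solved for the speed `v = u'` of the brane: `s v` has the sign of
`κ r`, and the brane is almost lightlike if the density `P` is large. -/
theorem speed_of_israel_radial {N h v s κ r P : ℝ} (hN : 0 < N) (hh : 0 < h)
    (hw : 0 < h⁻¹ - h * v ^ 2) (hs : s ^ 2 = 1) (hκ : κ ≠ 0) (hr : r ≠ 0) (hP : 0 < P)
    (hE : N * (s * (h ^ 2 * v) / (Real.sqrt h * Real.sqrt (1 - h ^ 2 * v ^ 2)) / r) = κ * P)
    (hlarge : h * N ^ 2 ≤ (κ * r * P) ^ 2) :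
    0 < s * κ * r * v ∧ 1 / 2 ≤ (h * v) ^ 2 ∧ (h * v) ^ 2 ≤ 1 := by
  have hX : 0 < 1 - h ^ 2 * v ^ 2 := by
    have := mul_pos hh hw
    rw [mul_sub, mul_inv_cancel₀ hh.ne'] at this
    linarith
  set D := Real.sqrt h * Real.sqrt (1 - h ^ 2 * v ^ 2) with hD
  have hDpos : 0 < D := mul_pos (Real.sqrt_pos.2 hh) (Real.sqrt_pos.2 hX)
  have hD2 : D ^ 2 = h * (1 - h ^ 2 * v ^ 2) := by
    rw [hD, mul_pow, Real.sq_sqrt hh.le, Real.sq_sqrt hX.le]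
  have hE' : N * (s * (h ^ 2 * v)) = κ * r * P * D := by
    field_simp at hE
    linear_combination hE
  have hsq : N ^ 2 * (h ^ 2 * v) ^ 2 = (κ * r * P) ^ 2 * (h * (1 - h ^ 2 * v ^ 2)) := by
    rw [← hD2, ← mul_pow (κ * r * P) D 2, ← hE']
    linear_combination (-(N ^ 2 * (h ^ 2 * v) ^ 2)) * hs
  refine ⟨?_, ?_, by nlinarith⟩
  · have h1 : N * h ^ 2 * (s * κ * r * v) = (κ * r) ^ 2 * P * D := by
      linear_combination κ * r * hE'
    have h2 : 0 < (κ * r) ^ 2 * P * D := by positivity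
    rw [← h1] at h2
    exact pos_of_mul_pos_right h2 (by positivity)
  -- Inserting `hlarge` into the squared equation gives `1 - (h v)² ≤ (h v)²`, whence the constant
  -- `1/2`.
  · have h1 : h * N ^ 2 * (h * (1 - h ^ 2 * v ^ 2)) ≤ N ^ 2 * (h ^ 2 * v) ^ 2 := by
      rw [hsq]
      exact mul_le_mul_of_nonneg_right hlarge (mul_pos hh hX).le
    have h2 : 0 < h ^ 2 * N ^ 2 := by positivity
    have h3 : h ^ 2 * N ^ 2 * (1 - (h * v) ^ 2) ≤ h ^ 2 * N ^ 2 * (h * v) ^ 2 := by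
      nlinarith
    linarith [le_of_mul_le_mul_left h3 h2]

/-! ### Speed and position of a brane at the singularity -/

section Branes

variable {n d : ℕ}
  {S₀ : Type*} [TopologicalSpace S₀] [ChartedSpace (EuclideanSpace ℝ (Fin n)) S₀]
  [IsManifold (𝓡 n) ∞ S₀]
  {S : Type*} [TopologicalSpace S] [ChartedSpace (EuclideanSpace ℝ (Fin d)) S]
  [IsManifold (𝓡 d) ∞ S]

theorem Side.sign_sq (s : Side) : s.sign ^ 2 = 1 := by cases s <;> simp [Side.sign]

variable {B : Bulk n} {g₀ : SemiRiemannianMetric n S₀} {κ : ℝ} {F : Matter n d S} {ε : ℝ}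
  {u : ℝ → ℝ} {φ : ℝ → S} {χ : (r : ℝ) → TangentSpace (𝓡 d) (φ r)}

/-- After multiplication by `r^{2n}` the scalar density tends to `L > 0`, the tension to `0`, and
the fluids stay nonnegative; `c = L / 2` works. -/
theorem IsGlobalSolution.exists_density_lower_bound (hn : n ≠ 0)
    (h : IsGlobalSolution B g₀ κ F ε u φ χ) : ∃ c, 0 < c ∧ ∀ᶠ r in 𝓝[≠] (0 : ℝ),
      c ≤ (∑ k, F.fluidDensity k r + scalarDensity B F u φ r + F.tension) * r ^ (2 * n) := by
  obtain ⟨L, hL, hlim⟩ := h.density_limit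
  have hLpos : 0 < L := (F.ρbar_nonneg 0).trans_lt hL
  have hc : Tendsto (fun r : ℝ => F.tension * r ^ (2 * n)) (𝓝[≠] 0) (𝓝 0) := by
    have hc' : Continuous fun r : ℝ => F.tension * r ^ (2 * n) := by fun_prop
    simpa [hn] using (hc'.tendsto 0).mono_left (nhdsWithin_le_nhds (s := {0}ᶜ))
  have hsum := hlim.add hc
  rw [add_zero] at hsum
  refine ⟨L / 2, half_pos hLpos, ?_⟩
  filter_upwards [hsum.eventually_const_lt (half_lt_self hLpos)] with r hr
  have h1 : 0 ≤ (∑ k, F.fluidDensity k r) * r ^ (2 * n) :=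
    mul_nonneg (Finset.sum_nonneg fun k _ => mul_nonneg (F.ρbar_nonneg k)
      (zpow_nonneg (abs_nonneg r) _)) (by rw [pow_mul]; positivity)
  linarith

/-- Near the singularity the graph of a brane is almost lightlike, `|u'| ~ |r|^{n-1}`, and the
direction in which it moves is determined by its position. -/
theorem SolvesEmbedding.speed_near_singularity [Nonempty S₀] (hn : Odd n) (hg₀ : g₀.IsRiemannian)
    (hκ : κ ≠ 0) {I : Set ℝ} (hI : IsOpen I) {s : Side}
    (h : IsGlobalSolution B g₀ κ F ε u φ χ) (hs : SolvesEmbedding B g₀ κ F I s u φ) :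
    ∃ a, 0 < a ∧ ∃ A, 0 < A ∧ ∀ᶠ r in 𝓝[≠] (0 : ℝ), r ∈ I →
      0 < s.sign * κ * r * deriv u r ∧ a * |r| ^ (n - 1) ≤ |deriv u r| ∧
        |deriv u r| ≤ A * |r| ^ (n - 1) := by
  obtain ⟨c, hc, hP⟩ := h.exists_density_lower_bound hn.pos.ne'
  obtain ⟨M, hM, hh⟩ := B.exists_tendsto_h_mul_pow hn
  have hnpos : (0 : ℝ) < n := by exact_mod_cast hn.pos
  -- This is `h̃ n² ≤ (κ r P)²` multiplied by `|r|^{4n-2}`: the left side is at most `2 M n²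
  -- |r|^{3n-1}`, the right side at least `(κ c)²`.
  have hsmall : ∀ᶠ r in 𝓝[≠] (0 : ℝ), 2 * M * n ^ 2 * |r| ^ (3 * n - 1) < (κ * c) ^ 2 := by
    have hc' : Continuous fun r : ℝ => 2 * M * n ^ 2 * |r| ^ (3 * n - 1) := by fun_prop
    have h3 : 3 * n - 1 ≠ 0 := by have := hn.pos; omega
    have := (hc'.tendsto 0).mono_left (nhdsWithin_le_nhds (s := {0}ᶜ))
    simp only [abs_zero, zero_pow h3, mul_zero] at this
    exact this.eventually_lt_const (by positivity)
  -- From `1/2 ≤ h̃ |u'| ≤ 1` (where `(h̃ u')² ≥ 1/2` is weakened to `1/4`) and `M/2 < h̃ |r|^{n-1}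
  -- < 2 M`.
  refine ⟨1 / (4 * M), by positivity, 2 / M, by positivity, ?_⟩
  filter_upwards [hP, hsmall, hh.eventually_lt_const (show M < 2 * M by linarith),
    hh.eventually_const_lt (half_lt_self hM), self_mem_nhdsWithin] with r hPr hsr hh1 hh2 hr0 hrI
  have hr0 : r ≠ 0 := hr0
  have hhr := B.h_pos hr0 (hs.region r hrI).2
  have heven : r ^ (n - 1) = |r| ^ (n - 1) := ((Nat.Odd.sub_odd hn odd_one).pow_abs r).symm
  have hrabs := abs_pos.2 hr0
  have hrn := pow_pos hrabs (n - 1)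
  rw [heven] at hh1 hh2
  set P := ∑ k, F.fluidDensity k r + scalarDensity B F u φ r + F.tension with hPdef
  have hr2 : r ^ (2 * n) = |r| ^ (2 * n) := by rw [pow_mul, pow_mul, sq_abs]
  rw [hr2] at hPr
  have hPpos : 0 < P := pos_of_mul_pos_left (hc.trans_le hPr) (by positivity)
  have hlarge : B.h r * (n : ℝ) ^ 2 ≤ (κ * r * P) ^ 2 := by
    have hpow : |r| ^ (4 * n - 2) = |r| ^ (n - 1) * |r| ^ (3 * n - 1) := by
      rw [← pow_add]; congr 1; have := hn.pos; omega
    have hpow' : r ^ 2 * |r| ^ (4 * n - 2) = (|r| ^ (2 * n)) ^ 2 := by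
      rw [← sq_abs, ← pow_add, ← pow_mul]; congr 1; have := hn.pos; omega
    have h1 : B.h r * (n : ℝ) ^ 2 * |r| ^ (4 * n - 2) ≤ (κ * r * P) ^ 2 * |r| ^ (4 * n - 2) := by
      calc B.h r * (n : ℝ) ^ 2 * |r| ^ (4 * n - 2)
          = (B.h r * |r| ^ (n - 1)) * ((n : ℝ) ^ 2 * |r| ^ (3 * n - 1)) := by rw [hpow]; ring
        _ ≤ 2 * M * ((n : ℝ) ^ 2 * |r| ^ (3 * n - 1)) := by gcongr
        _ ≤ (κ * c) ^ 2 := by linarith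
        _ = κ ^ 2 * c ^ 2 := mul_pow _ _ _
        _ ≤ κ ^ 2 * (P * |r| ^ (2 * n)) ^ 2 := by gcongr
        _ = (κ * r * P) ^ 2 * |r| ^ (4 * n - 2) := by
          linear_combination (-(κ ^ 2 * P ^ 2)) * hpow'
    exact le_of_mul_le_mul_right h1 (pow_pos hrabs _)
  obtain ⟨h1, h2, h3⟩ := speed_of_israel_radial hnpos hhr (hs.timelike r hrI) s.sign_sq hκ hr0 hPpos
    (hs.israel_radial hg₀ hI hrI) hlarge
  have h2' : 1 / 2 ≤ B.h r * |deriv u r| := by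
    have : (1 / 2 : ℝ) ^ 2 ≤ (B.h r * |deriv u r|) ^ 2 := by
      rw [mul_pow, sq_abs, ← mul_pow]; linarith
    exact le_of_sq_le_sq this (by positivity)
  have h3' : B.h r * |deriv u r| ≤ 1 := by
    have : (B.h r * |deriv u r|) ^ 2 ≤ 1 ^ 2 := by
      rw [mul_pow, sq_abs, ← mul_pow]; linarith
    exact le_of_sq_le_sq this zero_le_one
  refine ⟨h1, ?_, ?_⟩
  · rw [div_mul_eq_mul_div, one_mul, div_le_iff₀ (by positivity)]
    have := mul_le_mul_of_nonneg_right hh1.le (abs_nonneg (deriv u r))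
    nlinarith
  · rw [div_mul_eq_mul_div, le_div_iff₀ hM]
    have := mul_le_mul_of_nonneg_right hh2.le (abs_nonneg (deriv u r))
    nlinarith

/-- The position of a brane changes at the singularity, and its graph moves in the same direction
before and after. -/
theorem IsGlobalSolution.side_switch [Nonempty S₀] (hn : Odd n) (hg₀ : g₀.IsRiemannian)
    (hκ : κ ≠ 0) (hε : 0 < ε) (h : IsGlobalSolution B g₀ κ F ε u φ χ) {δ η : ℝ} (hδ : 0 < δ)
    (hη : 0 < η) {s s' : Side} (hs : SolvesEmbedding B g₀ κ F (Ioo (-δ) 0) s u φ)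
    (hs' : SolvesEmbedding B g₀ κ F (Ioo 0 η) s' u φ) :
    s ≠ s' ∧ ∀ᶠ r in 𝓝[≠] (0 : ℝ), s.sign * κ * deriv u r < 0 := by
  obtain ⟨a, ha, A, hA, hl⟩ := hs.speed_near_singularity hn hg₀ hκ isOpen_Ioo h
  obtain ⟨a', ha', A', hA', hr⟩ := hs'.speed_near_singularity hn hg₀ hκ isOpen_Ioo h
  have hnhds : ∀ᶠ r in 𝓝[≠] (0 : ℝ), r ∈ Ioo (-δ) η :=
    nhdsWithin_le_nhds (Ioo_mem_nhds (neg_lt_zero.2 hδ) hη)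
  have hb : ∀ᶠ r in 𝓝[≠] (0 : ℝ), min a a' * |r| ^ (n - 1) ≤ |deriv u r| ∧
      |deriv u r| ≤ max A A' * |r| ^ (n - 1) := by
    filter_upwards [hl, hr, hnhds, self_mem_nhdsWithin] with r hl hr hm h0
    have hpow : 0 ≤ |r| ^ (n - 1) := by positivity
    rcases lt_or_gt_of_ne (show r ≠ 0 from h0) with h0 | h0
    · obtain ⟨-, h1, h2⟩ := hl ⟨hm.1, h0⟩
      exact ⟨(mul_le_mul_of_nonneg_right (min_le_left _ _) hpow).trans h1,
        h2.trans (mul_le_mul_of_nonneg_right (le_max_left _ _) hpow)⟩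
    · obtain ⟨-, h1, h2⟩ := hr ⟨h0, hm.2⟩
      exact ⟨(mul_le_mul_of_nonneg_right (min_le_right _ _) hpow).trans h1,
        h2.trans (mul_le_mul_of_nonneg_right (le_max_right _ _) hpow)⟩
  -- Smoothness of `u` across `r = 0` links the two sides: both one-sided estimates concern one
  -- function with a single leading coefficient `l`.
  have hdiff : ContDiffOn ℝ (n - 1 : ℕ) (deriv u) (Ioo (-ε) ε) :=
    h.smooth_graph.deriv_of_isOpen isOpen_Ioo (by norm_cast; exact WithTop.coe_le_coe.2 le_top)
  obtain ⟨l, hl0, hlim⟩ := exists_tendsto_div_pow hε (lt_min ha ha') hdiff hb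
  -- Since `n - 1` is even, `r^{n-1} > 0` on both sides, and `u'` has the sign of `l` on both.
  have hsign : ∀ᶠ r in 𝓝[≠] (0 : ℝ), 0 < l * deriv u r := by
    have h1 := hlim.const_mul l
    filter_upwards [h1.eventually_const_lt (mul_self_pos.2 hl0), self_mem_nhdsWithin] with r hr hr0
    rw [← mul_div_assoc, (div_pos_iff_of_pos_right
      ((Nat.Odd.sub_odd hn odd_one).pow_pos hr0))] at hr
    exact hr
  -- The product of `s κ r u' > 0` and `l u' > 0` is `s κ l r u'²`, so `s κ l` has the sign of `r`:
  -- negative here, positive after the singularity.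
  have hleft : s.sign * κ * l < 0 := by
    have hev : ∀ᶠ r in 𝓝[<] (0 : ℝ), r ∈ Ioo (-δ) 0 := Ioo_mem_nhdsLT (neg_lt_zero.2 hδ)
    obtain ⟨r, h1, h2, h3⟩ := ((hl.filter_mono (nhdsLT_le_nhdsNE 0)).and
      ((hsign.filter_mono (nhdsLT_le_nhdsNE 0)).and hev)).exists
    have h4 := (h1 h3).1
    have h5 : 0 < (s.sign * κ * l) * r * (deriv u r) ^ 2 := by
      have := mul_pos h4 h2; nlinarith
    have h6 : 0 < (s.sign * κ * l) * r := pos_of_mul_pos_left h5 (sq_nonneg _)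
    exact neg_of_mul_pos_left h6 h3.2.le
  have hright : 0 < s'.sign * κ * l := by
    have hev : ∀ᶠ r in 𝓝[>] (0 : ℝ), r ∈ Ioo 0 η := Ioo_mem_nhdsGT hη
    obtain ⟨r, h1, h2, h3⟩ := ((hr.filter_mono (nhdsGT_le_nhdsNE 0)).and
      ((hsign.filter_mono (nhdsGT_le_nhdsNE 0)).and hev)).exists
    have h4 := (h1 h3).1
    have h5 : 0 < (s'.sign * κ * l) * r * (deriv u r) ^ 2 := by
      have := mul_pos h4 h2; nlinarith
    have h6 : 0 < (s'.sign * κ * l) * r := pos_of_mul_pos_left h5 (sq_nonneg _)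
    exact pos_of_mul_pos_left h6 h3.1.le
  refine ⟨fun hss => ?_, ?_⟩
  · rw [hss] at hleft; exact lt_asymm hleft hright
  · filter_upwards [hsign] with r hr
    have h1 : s.sign * κ * deriv u r * l ^ 2 < 0 := by
      have := mul_neg_of_neg_of_pos hleft hr; nlinarith
    exact neg_of_mul_neg_left h1 (sq_nonneg _)

end Branes

/-! ### Domains between two graphs -/

section Domains

variable {S₀ : Type*} [TopologicalSpace S₀] {I : Set ℝ} {Ω : Set (ℝ × ℝ × S₀)} {u u₁ u₂ : ℝ → ℝ}
  {s s₁ s₂ : Side}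

theorem IsDomainBoundedBy.symm (h : IsDomainBoundedBy I Ω u₁ s₁ u₂ s₂) :
    IsDomainBoundedBy I Ω u₂ s₂ u₁ s₁ where
  isOpen := h.isOpen
  isConnected := h.isConnected
  subset := h.subset
  boundary := by rw [h.boundary, union_comm]
  side₁ := h.side₂
  side₂ := h.side₁

theorem LiesOnSide.notMem (h : LiesOnSide I Ω u s) {q : ℝ × ℝ × S₀} (hq : q ∈ graphSet S₀ I u) :
    q ∉ Ω := by
  rw [(h q hq).self_of_nhds, hq.2]
  simp

theorem LiesOnSide.eventually_iff (h : LiesOnSide I Ω u s) {r : ℝ} (hr : r ∈ I) (x : S₀) :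
    ∀ᶠ t in 𝓝 (u r), (r, t, x) ∈ Ω ↔ 0 < s.sign * (u r - t) := by
  have hc : Tendsto (fun t : ℝ => (r, t, x)) (𝓝 (u r)) (𝓝 (r, u r, x)) :=
    Continuous.tendsto (by fun_prop) _
  exact hc.eventually (h (r, u r, x) ⟨hr, rfl⟩)

theorem LiesOnSide.eventually_mem_below (h : LiesOnSide I Ω u .upper) {r : ℝ} (hr : r ∈ I)
    (x : S₀) : ∀ᶠ t in 𝓝[<] (u r), (r, t, x) ∈ Ω := by
  filter_upwards [nhdsWithin_le_nhds (h.eventually_iff hr x), self_mem_nhdsWithin] with t ht htu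
  simpa [ht, Side.sign] using htu

theorem LiesOnSide.eventually_mem_above (h : LiesOnSide I Ω u .lower) {r : ℝ} (hr : r ∈ I)
    (x : S₀) : ∀ᶠ t in 𝓝[>] (u r), (r, t, x) ∈ Ω := by
  filter_upwards [nhdsWithin_le_nhds (h.eventually_iff hr x), self_mem_nhdsWithin] with t ht htu
  simpa [ht, Side.sign] using htu

theorem LiesOnSide.graphSet_subset_frontier (h : LiesOnSide I Ω u s) :
    graphSet S₀ I u ⊆ frontier Ω := by
  rintro ⟨r, t, x⟩ hq
  obtain ⟨hr, rfl⟩ : r ∈ I ∧ t = u r := hq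
  refine ⟨?_, fun hi => h.notMem ⟨hr, rfl⟩ (interior_subset hi)⟩
  have hc : Tendsto (fun t : ℝ => (r, t, x)) (𝓝 (u r)) (𝓝 (r, u r, x)) :=
    Continuous.tendsto (by fun_prop) _
  cases s
  · exact mem_closure_of_tendsto (hc.mono_left nhdsWithin_le_nhds) (h.eventually_mem_below hr x)
  · exact mem_closure_of_tendsto (hc.mono_left nhdsWithin_le_nhds) (h.eventually_mem_above hr x)

variable (S₀) in
/-- The region over `I` between the graphs of `lo` and `hi`. -/
def band (I : Set ℝ) (lo hi : ℝ → ℝ) : Set (ℝ × ℝ × S₀) :=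
  {q | q.1 ∈ I ∧ lo q.1 < q.2.1 ∧ q.2.1 < hi q.1}

theorem isOpen_strip_lt (hI : IsOpen I) {f g : ℝ × ℝ × S₀ → ℝ}
    (hf : ContinuousOn f {q | q.1 ∈ I}) (hg : ContinuousOn g {q | q.1 ∈ I}) :
    IsOpen {q : ℝ × ℝ × S₀ | q.1 ∈ I ∧ f q < g q} := by
  have := (hg.sub hf).isOpen_inter_preimage (hI.preimage continuous_fst) (isOpen_Ioi (a := (0 : ℝ)))
  convert this using 1
  ext q
  simp

theorem continuousOn_strip (hu : ContinuousOn u I) :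
    ContinuousOn (fun q : ℝ × ℝ × S₀ => u q.1) {q | q.1 ∈ I} :=
  hu.comp continuousOn_fst fun _ h => h

theorem isOpen_strip_below (hI : IsOpen I) (hu : ContinuousOn u I) :
    IsOpen {q : ℝ × ℝ × S₀ | q.1 ∈ I ∧ q.2.1 < u q.1} :=
  isOpen_strip_lt hI (by fun_prop) (continuousOn_strip hu)

theorem isOpen_strip_above (hI : IsOpen I) (hu : ContinuousOn u I) :
    IsOpen {q : ℝ × ℝ × S₀ | q.1 ∈ I ∧ u q.1 < q.2.1} :=
  isOpen_strip_lt hI (continuousOn_strip hu) (by fun_prop)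

/-- Linear interpolation between the two graphs makes the band a continuous image of `I × (0,1) ×
S₀`. -/
theorem isConnected_band [ConnectedSpace S₀] (hI : IsConnected I) {lo hi : ℝ → ℝ}
    (hlo : ContinuousOn lo I) (hhi : ContinuousOn hi I) (hlt : ∀ r ∈ I, lo r < hi r) :
    IsConnected (band S₀ I lo hi) := by
  have himg : band S₀ I lo hi = (fun q : ℝ × ℝ × S₀ =>
      (q.1, lo q.1 + q.2.1 * (hi q.1 - lo q.1), q.2.2)) '' (I ×ˢ Ioo (0 : ℝ) 1 ×ˢ univ) := by
    ext ⟨r, t, x⟩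
    constructor
    · rintro ⟨hr, h1, h2⟩
      have hpos := sub_pos.2 (hlt r hr)
      simp only at h1 h2 hr
      refine ⟨(r, (t - lo r) / (hi r - lo r), x), ⟨hr, ⟨?_, ?_⟩, mem_univ _⟩, ?_⟩
      · exact div_pos (by linarith) hpos
      · rw [div_lt_one hpos]; linarith
      · simp only [div_mul_cancel₀ _ hpos.ne', add_sub_cancel]
    · rintro ⟨⟨r', l, x'⟩, ⟨hr, ⟨h1, h2⟩, -⟩, heq⟩
      simp only [Prod.mk.injEq] at heq hr h1 h2
      obtain ⟨rfl, rfl, rfl⟩ := heq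
      have hpos := sub_pos.2 (hlt r' hr)
      refine ⟨hr, ?_, ?_⟩ <;> simp only <;> nlinarith
  rw [himg]
  refine (hI.prod ((isConnected_Ioo zero_lt_one).prod isConnected_univ)).image _ ?_
  have h1 : ContinuousOn (fun q : ℝ × ℝ × S₀ => lo q.1) (I ×ˢ Ioo (0 : ℝ) 1 ×ˢ univ) :=
    (continuousOn_strip hlo).mono fun q hq => hq.1
  have h2 : ContinuousOn (fun q : ℝ × ℝ × S₀ => hi q.1) (I ×ˢ Ioo (0 : ℝ) 1 ×ˢ univ) :=
    (continuousOn_strip hhi).mono fun q hq => hq.1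
  have h3 : ContinuousOn (fun q : ℝ × ℝ × S₀ => q.2.1) (I ×ˢ Ioo (0 : ℝ) 1 ×ˢ univ) := by fun_prop
  have h4 : ContinuousOn (fun q : ℝ × ℝ × S₀ => q.2.2) (I ×ˢ Ioo (0 : ℝ) 1 ×ˢ univ) := by fun_prop
  exact continuousOn_fst.prodMk ((h1.add (h3.mul (h2.sub h1))).prodMk h4)

theorem isDomainBoundedBy_band [ConnectedSpace S₀] (hI : IsOpen I) (hIc : IsConnected I)
    {lo hi : ℝ → ℝ} (hlo : ContinuousOn lo I) (hhi : ContinuousOn hi I)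
    (hlt : ∀ r ∈ I, lo r < hi r) : IsDomainBoundedBy I (band S₀ I lo hi) hi .upper lo .lower := by
  have hopen : IsOpen (band S₀ I lo hi) := by
    have := (isOpen_strip_above (S₀ := S₀) hI hlo).inter (isOpen_strip_below hI hhi)
    convert this using 1
    ext q; simp only [band, mem_ofPred_eq, mem_inter_iff]; tauto
  have hup : LiesOnSide I (band S₀ I lo hi) hi .upper := by
    rintro ⟨r, t, x⟩ ⟨hr, ht⟩
    simp only at hr ht
    have : (r, t, x) ∈ {q : ℝ × ℝ × S₀ | q.1 ∈ I ∧ lo q.1 < q.2.1} := ⟨hr, by simp [ht, hlt r hr]⟩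
    filter_upwards [(isOpen_strip_above hI hlo).mem_nhds this] with q hq
    simp [band, hq.1, hq.2, Side.sign]
  have hlow : LiesOnSide I (band S₀ I lo hi) lo .lower := by
    rintro ⟨r, t, x⟩ ⟨hr, ht⟩
    simp only at hr ht
    have : (r, t, x) ∈ {q : ℝ × ℝ × S₀ | q.1 ∈ I ∧ q.2.1 < hi q.1} := ⟨hr, by simp [ht, hlt r hr]⟩
    filter_upwards [(isOpen_strip_below hI hhi).mem_nhds this] with q hq
    simp [band, hq.1, hq.2, Side.sign]
  refine ⟨hopen, isConnected_band hIc hlo hhi hlt, fun q hq => hq.1, ?_, hup, hlow⟩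
  refine Subset.antisymm ?_ (union_subset
    (fun q hq => ⟨hup.graphSet_subset_frontier hq, hq.1⟩)
    (fun q hq => ⟨hlow.graphSet_subset_frontier hq, hq.1⟩))
  rintro q ⟨hq, hqI⟩
  rw [hopen.frontier_eq] at hq
  by_contra hne
  simp only [mem_union, graphSet, mem_ofPred_eq, not_or, not_and] at hne
  -- A point over `I` off both graphs is in the band, which is open and hence misses its own
  -- frontier, or strictly outside, where an open strip separates it from the band.
  have hcase : q.2.1 < lo q.1 ∨ hi q.1 < q.2.1 := by
    by_contra! hcon
    exact hq.2 ⟨hqI, lt_of_le_of_ne hcon.1 (Ne.symm (hne.2 hqI)),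
      lt_of_le_of_ne hcon.2 (hne.1 hqI)⟩
  rcases hcase with hc | hc
  · obtain ⟨q', h1, h2⟩ := mem_closure_iff.1 hq.1 _ (isOpen_strip_below hI hlo) ⟨hqI, hc⟩
    exact lt_asymm h1.2 h2.2.1
  · obtain ⟨q', h1, h2⟩ := mem_closure_iff.1 hq.1 _ (isOpen_strip_above hI hhi) ⟨hqI, hc⟩
    exact lt_asymm h1.2 h2.2.2

/-- A connected set over `I` that avoids a graph lies on one side of it. -/
theorem forall_lt_or_forall_gt {A : Set (ℝ × ℝ × S₀)} (hA : IsPreconnected A)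
    (hAI : ∀ q ∈ A, q.1 ∈ I) (hu : ContinuousOn u I) (hne : ∀ q ∈ A, q ∉ graphSet S₀ I u) :
    (∀ q ∈ A, q.2.1 < u q.1) ∨ (∀ q ∈ A, u q.1 < q.2.1) := by
  by_contra! hcon
  obtain ⟨⟨q, hq, h1⟩, q', hq', h2⟩ := hcon
  obtain ⟨p, hp, hpe⟩ := hA.intermediate_value₂ hq' hq
    (f := fun q : ℝ × ℝ × S₀ => q.2.1) (g := fun q : ℝ × ℝ × S₀ => u q.1)
    (by fun_prop) ((continuousOn_strip hu).mono hAI) h2 h1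
  exact hne p hp ⟨hAI p hp, hpe⟩

/-- A domain with an upper and a lower boundary brane is the region between them. -/
theorem IsDomainBoundedBy.eq_band [ConnectedSpace S₀] (hI : IsConnected I)
    (hu₁ : ContinuousOn u₁ I) (hu₂ : ContinuousOn u₂ I)
    (h : IsDomainBoundedBy I Ω u₁ .upper u₂ .lower) :
    (∀ r ∈ I, u₂ r < u₁ r) ∧ Ω = band S₀ I u₂ u₁ := by
  obtain ⟨x⟩ : Nonempty S₀ := inferInstance
  obtain ⟨r₀, hr₀⟩ := hI.nonempty
  -- By connectedness `Ω` lies on one side of the graph; it has points just below an upper brane, so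
  -- it lies below.
  have hbelow : ∀ q ∈ Ω, q.2.1 < u₁ q.1 := by
    refine (forall_lt_or_forall_gt h.isConnected.isPreconnected h.subset hu₁
      fun q hq hg => h.side₁.notMem hg hq).resolve_right fun hall => ?_
    obtain ⟨t, ht, htu⟩ := ((h.side₁.eventually_mem_below hr₀ x).and self_mem_nhdsWithin).exists
    exact lt_asymm (hall _ ht) htu
  have habove : ∀ q ∈ Ω, u₂ q.1 < q.2.1 := by
    refine (forall_lt_or_forall_gt h.isConnected.isPreconnected h.subset hu₂
      fun q hq hg => h.side₂.notMem hg hq).resolve_left fun hall => ?_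
    obtain ⟨t, ht, htu⟩ := ((h.side₂.eventually_mem_above hr₀ x).and self_mem_nhdsWithin).exists
    exact lt_asymm (hall _ ht) htu
  have hlt : ∀ r ∈ I, u₂ r < u₁ r := by
    intro r hr
    obtain ⟨t, ht⟩ := (h.side₁.eventually_mem_below hr x).exists
    exact (habove _ ht).trans (hbelow _ ht)
  refine ⟨hlt, Subset.antisymm (fun q hq => ⟨h.subset q hq, habove q hq, hbelow q hq⟩) ?_⟩
  obtain ⟨q₀, hq₀⟩ := h.isConnected.nonempty
  -- `Ω` is open, and relatively closed in the band because its frontier over `I` consists of the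
  -- graphs, which the band avoids. Connectedness of the band gives equality.
  refine (isConnected_band hI hu₂ hu₁ hlt).isPreconnected.subset_of_closure_inter_subset h.isOpen
    ⟨q₀, ⟨h.subset _ hq₀, habove _ hq₀, hbelow _ hq₀⟩, hq₀⟩ ?_
  rintro p ⟨hpc, hp⟩
  by_contra hpΩ
  have : p ∈ graphSet S₀ I u₁ ∪ graphSet S₀ I u₂ := by
    rw [← h.boundary]; exact ⟨⟨hpc, fun hi => hpΩ (interior_subset hi)⟩, hp.1⟩
  rcases this with hg | hg
  · exact hp.2.2.ne hg.2
  · exact hp.2.1.ne' hg.2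

end Domains

/-- A function that vanishes at `0` and has a negative derivative near `0`. -/
theorem exists_pos_left_neg_right {f : ℝ → ℝ} {ε : ℝ} (hε : 0 < ε)
    (hf : ContinuousOn f (Ioo (-ε) ε)) (h0 : f 0 = 0) (hd : ∀ᶠ r in 𝓝[≠] (0 : ℝ), deriv f r < 0) :
    ∃ η ∈ Ioc 0 ε, (∀ r ∈ Ioo (-η) 0, 0 < f r) ∧ ∀ r ∈ Ioo 0 η, f r < 0 := by
  obtain ⟨η, hη, hball⟩ := Metric.mem_nhdsWithin_iff.1 hd
  have hd' : ∀ r, r ≠ 0 → -η < r → r < η → deriv f r < 0 := fun r hr h1 h2 =>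
    hball ⟨by simpa [abs_lt] using ⟨h1, h2⟩, hr⟩
  have hmin : 0 < min η ε := lt_min hη hε
  have h1 : min η ε ≤ η := min_le_left _ _
  have h2 : min η ε ≤ ε := min_le_right _ _
  refine ⟨min η ε, ⟨hmin, h2⟩, fun r hr => ?_, fun r hr => ?_⟩
  -- No information on the derivative at `0` is needed: its sign is required only in the interior of
  -- an interval ending at `0`.
  · have hanti : StrictAntiOn f (Icc r 0) := by
      refine strictAntiOn_of_deriv_neg (convex_Icc _ _) (hf.mono fun y hy => ?_) fun y hy => ?_
      · exact ⟨by linarith [hr.1, hy.1], by linarith [hy.2]⟩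
      · rw [interior_Icc] at hy
        exact hd' y hy.2.ne (by linarith [hr.1, hy.1]) (by linarith [hy.2])
    rw [← h0]
    exact hanti (left_mem_Icc.2 hr.2.le) (right_mem_Icc.2 hr.2.le) hr.2
  · have hanti : StrictAntiOn f (Icc 0 r) := by
      refine strictAntiOn_of_deriv_neg (convex_Icc _ _) (hf.mono fun y hy => ?_) fun y hy => ?_
      · exact ⟨by linarith [hy.1], by linarith [hr.2, hy.2]⟩
      · rw [interior_Icc] at hy
        exact hd' y hy.1.ne' (by linarith [hy.1]) (by linarith [hr.2, hy.2])
    rw [← h0]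
    exact hanti (left_mem_Icc.2 hr.1.le) (right_mem_Icc.2 hr.1.le) hr.1

/-! ### Crossing of two branes -/

section Configurations

variable {n d₁ d₂ : ℕ}
  {S₀ : Type*} [TopologicalSpace S₀] [ChartedSpace (EuclideanSpace ℝ (Fin n)) S₀]
  [IsManifold (𝓡 n) ∞ S₀] [ConnectedSpace S₀]
  {S₁ : Type*} [TopologicalSpace S₁] [ChartedSpace (EuclideanSpace ℝ (Fin d₁)) S₁]
  [IsManifold (𝓡 d₁) ∞ S₁]
  {S₂ : Type*} [TopologicalSpace S₂] [ChartedSpace (EuclideanSpace ℝ (Fin d₂)) S₂]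
  [IsManifold (𝓡 d₂) ∞ S₂]
  {B : Bulk n} {g₀ : SemiRiemannianMetric n S₀} {κ : ℝ} {F₁ : Matter n d₁ S₁} {F₂ : Matter n d₂ S₂}
  {ε δ η : ℝ}
  {u₁ : ℝ → ℝ} {φ₁ : ℝ → S₁} {χ₁ : (r : ℝ) → TangentSpace (𝓡 d₁) (φ₁ r)}
  {u₂ : ℝ → ℝ} {φ₂ : ℝ → S₂} {χ₂ : (r : ℝ) → TangentSpace (𝓡 d₂) (φ₂ r)}

/-- The side of a reflected upper brane is lower. -/
theorem IsGlobalSolution.eq_lower (hn : Odd n) (hg₀ : g₀.IsRiemannian)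
    (hκ : κ ≠ 0) (hε : 0 < ε) (h : IsGlobalSolution B g₀ κ F₁ ε u₁ φ₁ χ₁) (hδ : 0 < δ) (hη : 0 < η)
    {s : Side} (hs : SolvesEmbedding B g₀ κ F₁ (Ioo (-δ) 0) .upper u₁ φ₁)
    (hs' : SolvesEmbedding B g₀ κ F₁ (Ioo 0 η) s u₁ φ₁) : s = .lower := by
  have := (h.side_switch hn hg₀ hκ hε hδ hη hs hs').1
  cases s <;> simp_all

/-- The side of a reflected lower brane is upper. -/
theorem IsGlobalSolution.eq_upper (hn : Odd n) (hg₀ : g₀.IsRiemannian)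
    (hκ : κ ≠ 0) (hε : 0 < ε) (h : IsGlobalSolution B g₀ κ F₁ ε u₁ φ₁ χ₁) (hδ : 0 < δ) (hη : 0 < η)
    {s : Side} (hs : SolvesEmbedding B g₀ κ F₁ (Ioo (-δ) 0) .lower u₁ φ₁)
    (hs' : SolvesEmbedding B g₀ κ F₁ (Ioo 0 η) s u₁ φ₁) : s = .upper := by
  have := (h.side_switch hn hg₀ hκ hε hδ hη hs hs').1
  cases s <;> simp_all

/-- An upper and a lower brane that collide cross each other, in a direction given by `κ`. -/
theorem IsGlobalSolution.exists_crossing (hn : Odd n) (hg₀ : g₀.IsRiemannian)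
    (hκ : κ ≠ 0) (hε : 0 < ε) (h₁ : IsGlobalSolution B g₀ κ F₁ ε u₁ φ₁ χ₁)
    (h₂ : IsGlobalSolution B g₀ κ F₂ ε u₂ φ₂ χ₂) (hδ : 0 < δ)
    (hs₁ : SolvesEmbedding B g₀ κ F₁ (Ioo (-δ) 0) .upper u₁ φ₁)
    (hs₂ : SolvesEmbedding B g₀ κ F₂ (Ioo (-δ) 0) .lower u₂ φ₂) (h0 : u₁ 0 = u₂ 0) :
    ∃ η ∈ Ioc 0 ε, (∀ r ∈ Ioo (-η) 0, 0 < κ * (u₁ r - u₂ r)) ∧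
      ∀ r ∈ Ioo 0 η, κ * (u₁ r - u₂ r) < 0 := by
  obtain ⟨t₁, ht₁⟩ := h₁.big_bang
  obtain ⟨t₂, ht₂⟩ := h₂.big_bang
  refine exists_pos_left_neg_right hε
    (continuousOn_const.mul (h₁.smooth_graph.continuousOn.sub h₂.smooth_graph.continuousOn))
    (by simp [h0]) ?_
  have hnhds : ∀ᶠ r in 𝓝[≠] (0 : ℝ), r ∈ Ioo (-ε) ε :=
    nhdsWithin_le_nhds (Ioo_mem_nhds (neg_lt_zero.2 hε) hε)
  filter_upwards [(h₁.side_switch hn hg₀ hκ hε hδ hε hs₁ ht₁).2,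
    (h₂.side_switch hn hg₀ hκ hε hδ hε hs₂ ht₂).2, hnhds] with r h1 h2 hr
  have hd₁ := (h₁.smooth_graph.contDiffAt (isOpen_Ioo.mem_nhds hr)).differentiableAt (by simp)
  have hd₂ := (h₂.smooth_graph.contDiffAt (isOpen_Ioo.mem_nhds hr)).differentiableAt (by simp)
  have : deriv (fun r => κ * (u₁ r - u₂ r)) r = κ * (deriv u₁ r - deriv u₂ r) :=
    ((hd₁.hasDerivAt.sub hd₂.hasDerivAt).const_mul κ).deriv
  rw [this]
  -- The positions are opposite, so `κ u₁' < 0` and `-κ u₂' < 0`, and the two add up.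
  simp only [Side.sign] at h1 h2
  linarith

theorem IsConfiguration.order_and_eq_band (hη : 0 < η) {Ω : Set (ℝ × ℝ × S₀)}
    (h : IsConfiguration B g₀ κ F₁ F₂ (Ioo 0 η) Ω u₁ φ₁ .lower u₂ φ₂ .upper) :
    (∀ r ∈ Ioo 0 η, u₁ r < u₂ r) ∧ Ω = band S₀ (Ioo 0 η) u₁ u₂ :=
  h.domain.symm.eq_band (isConnected_Ioo hη) h.brane₂.smooth_graph.continuousOn
    h.brane₁.smooth_graph.continuousOn

/-- Two branes with the right order and positions bound the region between them over `(0, η)`. -/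
theorem isConfiguration_band_right (hη : 0 < η)
    (hs₁ : SolvesEmbedding B g₀ κ F₁ (Ioo 0 η) .lower u₁ φ₁)
    (hs₂ : SolvesEmbedding B g₀ κ F₂ (Ioo 0 η) .upper u₂ φ₂)
    (hlt : ∀ r ∈ Ioo 0 η, u₁ r < u₂ r) :
    IsConfiguration B g₀ κ F₁ F₂ (Ioo 0 η) (band S₀ (Ioo 0 η) u₁ u₂) u₁ φ₁ .lower u₂ φ₂ .upper :=
  ⟨(isDomainBoundedBy_band isOpen_Ioo (isConnected_Ioo hη) hs₁.smooth_graph.continuousOn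
    hs₂.smooth_graph.continuousOn hlt).symm, hs₁, hs₂⟩

end Configurations

end BraneWorld

theorem theorem0p3 {n d₁ d₂ : ℕ} (hn : Odd n)
    {S₀ : Type*} [TopologicalSpace S₀] [ChartedSpace (EuclideanSpace ℝ (Fin n)) S₀]
    [IsManifold (𝓡 n) ∞ S₀] [ConnectedSpace S₀]
    {S₁ : Type*} [TopologicalSpace S₁] [ChartedSpace (EuclideanSpace ℝ (Fin d₁)) S₁]
    [IsManifold (𝓡 d₁) ∞ S₁]
    {S₂ : Type*} [TopologicalSpace S₂] [ChartedSpace (EuclideanSpace ℝ (Fin d₂)) S₂]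
    [IsManifold (𝓡 d₂) ∞ S₂]
    (B : Bulk n) (g₀ : SemiRiemannianMetric n S₀) (hg₀ : g₀.IsRiemannian)
    (hcurv : g₀.HasConstantCurvature B.curv)
    (κ : ℝ) (hκ : κ ≠ 0)
    (F₁ : Matter n d₁ S₁) (hw₁ : ∀ k, Odd (F₁.w k))
    (F₂ : Matter n d₂ S₂) (hw₂ : ∀ k, Odd (F₂.w k))
    (ε : ℝ) (hε : 0 < ε)
    (u₁ : ℝ → ℝ) (φ₁ : ℝ → S₁) (χ₁ : (r : ℝ) → TangentSpace (𝓡 d₁) (φ₁ r))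
    (u₂ : ℝ → ℝ) (φ₂ : ℝ → S₂) (χ₂ : (r : ℝ) → TangentSpace (𝓡 d₂) (φ₂ r))
    (h₁ : IsGlobalSolution B g₀ κ F₁ ε u₁ φ₁ χ₁)
    (h₂ : IsGlobalSolution B g₀ κ F₂ ε u₂ φ₂ χ₂) :
    -- mirror images, for a domain bounded by the upper brane `N₁` and the lower brane `N₂`
    (∀ δ ∈ Ioc 0 ε, ∀ Ω : Set (ℝ × ℝ × S₀),
      IsConfiguration B g₀ κ F₁ F₂ (Ioo (-δ) 0) Ω u₁ φ₁ Side.upper u₂ φ₂ Side.lower →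
        ((∃ η ∈ Ioc 0 ε, ∃ (Ω' : Set (ℝ × ℝ × S₀)) (s₁ s₂ : Side),
            IsConfiguration B g₀ κ F₁ F₂ (Ioo 0 η) Ω' u₁ φ₁ s₁ u₂ φ₂ s₂) ↔ u₁ 0 = u₂ 0) ∧
        (∀ η ∈ Ioc 0 ε, ∀ (Ω' : Set (ℝ × ℝ × S₀)) (s₁ s₂ : Side),
          IsConfiguration B g₀ κ F₁ F₂ (Ioo 0 η) Ω' u₁ φ₁ s₁ u₂ φ₂ s₂ →
            s₁ = Side.lower ∧ s₂ = Side.upper ∧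
              Ω' = {q | q.1 ∈ Ioo 0 η ∧ u₁ q.1 < q.2.1 ∧ q.2.1 < u₂ q.1})) ∧
    -- collision by translation in the `t`-direction
    (∃ c : ℝ, IsGlobalSolution B g₀ κ F₂ ε (fun r => u₂ r + c) φ₂ χ₂ ∧ u₁ 0 = u₂ 0 + c ∧
      (0 < κ →
        SolvesEmbedding B g₀ κ F₁ (Ioo (-ε) 0) Side.upper u₁ φ₁ →
        SolvesEmbedding B g₀ κ F₂ (Ioo (-ε) 0) Side.lower u₂ φ₂ →
        ∃ η ∈ Ioc 0 ε, ∃ Ω Ω' : Set (ℝ × ℝ × S₀),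
          IsConfiguration B g₀ κ F₁ F₂ (Ioo (-η) 0) Ω u₁ φ₁ Side.upper
            (fun r => u₂ r + c) φ₂ Side.lower ∧
          IsConfiguration B g₀ κ F₁ F₂ (Ioo 0 η) Ω' u₁ φ₁ Side.lower
            (fun r => u₂ r + c) φ₂ Side.upper)) := by

  have hIε : (0 : ℝ) ∈ Ioo (-ε) ε := ⟨neg_lt_zero.2 hε, hε⟩
  have hswitch : ∀ {δ η : ℝ} {s₁ s₂ : Side}, 0 < δ → 0 < η →
      SolvesEmbedding B g₀ κ F₁ (Ioo (-δ) 0) .upper u₁ φ₁ →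
      SolvesEmbedding B g₀ κ F₂ (Ioo (-δ) 0) .lower u₂ φ₂ →
      SolvesEmbedding B g₀ κ F₁ (Ioo 0 η) s₁ u₁ φ₁ →
      SolvesEmbedding B g₀ κ F₂ (Ioo 0 η) s₂ u₂ φ₂ → s₁ = .lower ∧ s₂ = .upper :=
    fun hδ hη a₁ a₂ b₁ b₂ => ⟨h₁.eq_lower hn hg₀ hκ hε hδ hη a₁ b₁,
      h₂.eq_upper hn hg₀ hκ hε hδ hη a₂ b₂⟩
  obtain ⟨t₁, ht₁⟩ := h₁.big_bang
  obtain ⟨t₂, ht₂⟩ := h₂.big_bang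
  refine ⟨fun δ hδ Ω hΩ => ⟨⟨?_, fun h0 => ?_⟩, ?_⟩, u₁ 0 - u₂ 0, h₂.translate _, by ring, ?_⟩
  · rintro ⟨η, hη, Ω', s₁, s₂, hΩ'⟩
    obtain ⟨rfl, rfl⟩ := hswitch hδ.1 hη.1 hΩ.brane₁ hΩ.brane₂ hΩ'.brane₁ hΩ'.brane₂
    have hright := (hΩ'.order_and_eq_band hη.1).1
    have hleft := (hΩ.domain.eq_band (isConnected_Ioo (neg_lt_zero.2 hδ.1))
      hΩ.brane₁.smooth_graph.continuousOn hΩ.brane₂.smooth_graph.continuousOn).1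
    have hc₁ := h₁.smooth_graph.continuousOn.continuousAt (isOpen_Ioo.mem_nhds hIε)
    have hc₂ := h₂.smooth_graph.continuousOn.continuousAt (isOpen_Ioo.mem_nhds hIε)
    -- The order after the singularity gives `u₁ 0 ≤ u₂ 0` in the limit, the order before it the
    -- reverse inequality.
    refine le_antisymm ?_ ?_
    · refine le_of_tendsto_of_tendsto (hc₁.mono_left (nhdsWithin_le_nhds (s := Ioi 0)))
        (hc₂.mono_left nhdsWithin_le_nhds) ?_
      filter_upwards [Ioo_mem_nhdsGT hη.1] with r hr using (hright r hr).le
    · refine le_of_tendsto_of_tendsto (hc₂.mono_left (nhdsWithin_le_nhds (s := Iio 0)))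
        (hc₁.mono_left nhdsWithin_le_nhds) ?_
      filter_upwards [Ioo_mem_nhdsLT (neg_lt_zero.2 hδ.1)] with r hr using (hleft r hr).le
  · obtain ⟨η, hη, hl, hr⟩ := h₁.exists_crossing hn hg₀ hκ hε h₂ hδ.1 hΩ.brane₁ hΩ.brane₂ h0
    have hleft := (hΩ.domain.eq_band (isConnected_Ioo (neg_lt_zero.2 hδ.1))
      hΩ.brane₁.smooth_graph.continuousOn hΩ.brane₂.smooth_graph.continuousOn).1
    -- Before the singularity both `u₁ - u₂ > 0`, from the given domain, and `κ (u₁ - u₂) > 0`, from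
    -- the crossing; so the existence of `Ω` with collision forces `κ > 0`. The point `-(min η δ /
    -- 2)` lies in both intervals.
    have hκpos : 0 < κ := by
      have hmin := lt_min hη.1 hδ.1
      have h1 := min_le_left η δ
      have h2 := min_le_right η δ
      refine pos_of_mul_pos_left (hl (-(min η δ / 2)) ⟨by linarith, by linarith⟩) ?_
      exact (sub_pos.2 (hleft (-(min η δ / 2)) ⟨by linarith, by linarith⟩)).le
    obtain ⟨rfl, rfl⟩ := hswitch hδ.1 hε hΩ.brane₁ hΩ.brane₂ ht₁ ht₂
    exact ⟨η, hη, _, .lower, .upper, isConfiguration_band_right hη.1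
      (ht₁.mono (Ioo_subset_Ioo_right hη.2)) (ht₂.mono (Ioo_subset_Ioo_right hη.2))
      fun r hr' => sub_neg.1 (neg_of_mul_neg_right (hr r hr') hκpos.le)⟩
  · intro η hη Ω' s₁ s₂ hΩ'
    obtain ⟨rfl, rfl⟩ := hswitch hδ.1 hη.1 hΩ.brane₁ hΩ.brane₂ hΩ'.brane₁ hΩ'.brane₂
    exact ⟨rfl, rfl, (hΩ'.order_and_eq_band hη.1).2⟩
  · intro hκpos hs₁ hs₂
    obtain ⟨rfl, rfl⟩ := hswitch hε hε hs₁ hs₂ ht₁ ht₂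
    have hs₂' := hs₂.translate (u₁ 0 - u₂ 0)
    -- The translated branes collide by the choice `c = u₁ 0 - u₂ 0`; as `κ > 0`, the crossing
    -- yields the required order on each side.
    obtain ⟨η, hη, hl, hr⟩ := h₁.exists_crossing hn hg₀ hκ hε (h₂.translate (u₁ 0 - u₂ 0)) hε hs₁ hs₂'
      (by ring)
    have hsub : Ioo (-η) 0 ⊆ Ioo (-ε) 0 := Ioo_subset_Ioo_left (neg_le_neg hη.2)
    refine ⟨η, hη, band S₀ (Ioo (-η) 0) (fun r => u₂ r + (u₁ 0 - u₂ 0)) u₁, _,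
      ⟨isDomainBoundedBy_band isOpen_Ioo (isConnected_Ioo (neg_lt_zero.2 hη.1))
        (hs₂'.mono hsub).smooth_graph.continuousOn (hs₁.mono hsub).smooth_graph.continuousOn
        fun r hr' => sub_pos.1 (pos_of_mul_pos_right (hl r hr') hκpos.le),
        hs₁.mono hsub, hs₂'.mono hsub⟩,
      isConfiguration_band_right hη.1 (ht₁.mono (Ioo_subset_Ioo_right hη.2))
        ((ht₂.translate _).mono (Ioo_subset_Ioo_right hη.2))
        fun r hr' => sub_neg.1 (neg_of_mul_neg_right (hr r hr') hκpos.le)⟩
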